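/- **Setting.** Let $n,N\ge 0$ be integers, $[n]=\{1,\dots,n\}$, $[N]=\{1,\dots,N\}$. For $x\in[N]^n$ and $i\in[N]$ put $n_i(x)=|\{a\in[n]: x_a=i\}|$ and let $\Lambda^n=\{x\in[N]^n : n_i(x)\text{ is even for all } i\in[N]\}$, with the measure $\pi(x)=\prod_{i=1}^N (n_i(x)!!)^2$, where $0!!=1$, $1!!=0$ and $k!!=(k-1)\,(k-2)!!$ for $k\ge 2$. For labels $a\ne b$ and sites $i,j$, let $m_{ab}^{ij}x$ be $x$ with both particles $a,b$ moved to $j$ if $x_a=x_b=i$, and $m_{ab}^{ij}x=x$ otherwise; let $s_{ab}^{ij}x$ be $x$ with the positions of $a$ and $b$ exchanged if $x_a=i$ and $x_b=j$, and $s_{ab}^{ij}x=x$ otherwise. For $i<j$ and $f:\Lambda^n\to\mathbb R$ set $$\mathcal L_{ij}f(x)=\frac{n_j(x)+1}{n_i(x)-1}\sum_{a\ne b}\bigl(f(m_{ab}^{ij}x)-f(x)\bigr)+\frac{n_i(x)+1}{n_j(x)-1}\sum_{a\neq b}\bigl(f(m_{ab}^{ji}x)-f(x)\bigr)-2\sum_{a\ne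 b}\bigl(f(s_{ab}^{ij}x)-f(x)\bigr),$$ the sums being over ordered pairs of distinct labels in $[n]$. For $y\in\Lambda^n$ and real $\ell>0$, let $\sim$ be the equivalence relation on $[N]$ generated by all pairs $(i,j)$ for which there is $a\in[n]$ with $|i-y_a|\le \ell$ and $|j-y_a|\le\ell$. Let $$\Lambda^n_{y,\ell}=\{x\in\Lambda^n : x_a\sim y_a\text{ for all }a\in[n]\},\qquad \langle f,g\rangle_{y,\ell}=\sum_{x\in\Lambda^n_{y,\ell}}\pi(x)f(x)g(x).$$ Given real coefficients $c_{ij}$, $1\le i<j\le N$, the local Dirichlet form is $$D_{y,\ell}(f)=\sum_{i<j,\ i\sim j}c_{ij}\,\langle f,(-\mathcal L_{ij})f\rangle_{y,\ell}.$$ For $x\in\Lambda^n$ let $\mathcal P_x$ be the partition of $[n]$ in which $a,b$ are in the same part iff $x_a=x_b$, and write $\mathcal P_z\le \mathcal P_x$ if $\mathcal P_z$ refines $\mathcal P_x$. The local projection is $$P_{y,\ell}f(x)=\frac{\sum_{z\in\Lambda^n_{y,\ell},\ \mathcal P_z\le\mathcal P_x}\pi(z)f(z)}{\sum_{z\in\Lambda^n_{y,\ell},\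 \mathcal P_z\le\mathcal P_x}\pi(z)},\qquad x\in\Lambda^n_{y,\ell}.$$ **Proposition 6.3 (Poincaré inequality).** For every $n$ there is a constant $C_n>0$, depending only on $n$, such that for every $N$, every $\upsilon>0$ and all real coefficients with $c_{ij}>\upsilon|i-j|^{-2}$ for all $i<j$ in $[N]$, $$\sum_{x\in\Lambda^n_{y,\ell}}\pi(x)\,|f(x)-P_{y,\ell}f(x)|^2\le C_n\,\frac{\ell}{\upsilon}\,D_{y,\ell}(f)$$ for all $y\in\Lambda^n$, all $\ell>0$ and all $f:\Lambda^n_{y,\ell}\to\mathbb R$. -/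

import Mathlib

namespace ColoredFlow

/-- The particle number `n_i(x)`: how many of the `n` labelled particles sit at site `i`. -/
def particleNumber {n N : ℕ} (i : Fin N) (x : Fin n → Fin N) : ℕ :=
  (Finset.univ.filter fun a => x a = i).card

/-- The space `Λⁿ` of even distinguishable particle configurations of `n` labelled particles on
`N` sites (sites are numbered from `0`; only differences of sites matter). -/
def evenConfigs (n N : ℕ) : Finset (Fin n → Fin N) :=
  Finset.univ.filter fun x => ∀ i, Even (particleNumber i x)

/-- The double factorial in the convention `k!! = (k - 1) (k - 2)!!`, `0!! = 1`, `1!! = 0`. -/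
def dfact : ℕ → ℕ
  | 0 => 1
  | 1 => 0
  | k + 2 => (k + 1) * dfact k

/-- The reversible measure `π(x) = ∏ᵢ (nᵢ(x)!!)²`. -/
def weight {n N : ℕ} (x : Fin n → Fin N) : ℝ :=
  ∏ i : Fin N, (dfact (particleNumber i x) : ℝ) ^ 2

/-- The two particle jump `m_{ab}^{ij}`: if particles `a` and `b` are both at site `i`,
both move to site `j`; otherwise nothing happens. -/
def jump {n N : ℕ} (a b : Fin n) (i j : Fin N) (x : Fin n → Fin N) : Fin n → Fin N :=
  fun c => if (c = a ∨ c = b) ∧ x a = i ∧ x b = i then j else x c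

/-- The two particle swap `s_{ab}^{ij}`: if particle `a` is at site `i` and particle `b` is at
site `j`, they exchange positions; otherwise nothing happens. -/
def swap {n N : ℕ} (a b : Fin n) (i j : Fin N) (x : Fin n → Fin N) : Fin n → Fin N :=
  fun c => if x a = i ∧ x b = j then (if c = a then j else if c = b then i else x c) else x c

/-- The move operator. On even configurations the denominators `n_i(x) - 1` never vanish. -/
noncomputable def moveOp {n N : ℕ} (i j : Fin N) (f : (Fin n → Fin N) → ℝ)
    (x : Fin n → Fin N) : ℝ :=
  ((particleNumber j x : ℝ) + 1) / ((particleNumber i x : ℝ) - 1) *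
      ∑ a : Fin n, ∑ b ∈ Finset.univ.filter (fun b => a ≠ b), (f (jump a b i j x) - f x) +
    ((particleNumber i x : ℝ) + 1) / ((particleNumber j x : ℝ) - 1) *
      ∑ a : Fin n, ∑ b ∈ Finset.univ.filter (fun b => a ≠ b), (f (jump a b j i x) - f x)

/-- The exchange operator. -/
def exchOp {n N : ℕ} (i j : Fin N) (f : (Fin n → Fin N) → ℝ) (x : Fin n → Fin N) : ℝ :=
  2 * ∑ a : Fin n, ∑ b ∈ Finset.univ.filter (fun b => a ≠ b), (f (swap a b i j x) - f x)

/-- The two-site generator `𝓛_{ij}`: move minus exchange. -/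
noncomputable def gen {n N : ℕ} (i j : Fin N) (f : (Fin n → Fin N) → ℝ)
    (x : Fin n → Fin N) : ℝ :=
  moveOp i j f x - exchOp i j f x

/-- The set of position pairs `R₀(y, ℓ)`, as a relation on sites. -/
def nearRel {n N : ℕ} (y : Fin n → Fin N) (ℓ : ℝ) (i j : Fin N) : Prop :=
  ∃ a : Fin n, |(i : ℝ) - (y a : ℝ)| ≤ ℓ ∧ |(j : ℝ) - (y a : ℝ)| ≤ ℓ

/-- The equivalence relation `R(y, ℓ)` on sites generated by `R₀(y, ℓ)`. -/
def localRel {n N : ℕ} (y : Fin n → Fin N) (ℓ : ℝ) : Fin N → Fin N → Prop :=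
  Relation.EqvGen (nearRel y ℓ)

open Classical in
/-- The local `ℓ`-neighborhood `Λⁿ_{y,ℓ}` centered at `y`. -/
noncomputable def localNbhd {n N : ℕ} (y : Fin n → Fin N) (ℓ : ℝ) : Finset (Fin n → Fin N) :=
  (evenConfigs n N).filter fun x => ∀ a, localRel y ℓ (x a) (y a)

/-- The local inner product `⟨f, g⟩_{y,ℓ}`. -/
noncomputable def localInner {n N : ℕ} (y : Fin n → Fin N) (ℓ : ℝ)
    (f g : (Fin n → Fin N) → ℝ) : ℝ :=
  ∑ x ∈ localNbhd y ℓ, weight x * f x * g x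

open Classical in
/-- The local Dirichlet form `D_{y,ℓ}(f)`, the sum being over unordered pairs of distinct
equivalent sites, each pair represented with `i < j`. -/
noncomputable def localDirichlet {n N : ℕ} (c : Fin N → Fin N → ℝ) (y : Fin n → Fin N) (ℓ : ℝ)
    (f : (Fin n → Fin N) → ℝ) : ℝ :=
  ∑ i : Fin N, ∑ j ∈ Finset.univ.filter (fun j => i < j ∧ localRel y ℓ i j),
    c i j * localInner y ℓ f (fun x => -gen i j f x)

/-- The position partition of `x`, as an equivalence relation on labels: `a` and `b` are in the
same part iff `x a = x b`. The order on `Setoid` is refinement of partitions. -/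
def positionPartition {n N : ℕ} (x : Fin n → Fin N) : Setoid (Fin n) :=
  Setoid.ker x

open Classical in
/-- The local projection operator `P_{y,ℓ}`: the `π`-average of `f` over those `z` in the local
neighborhood whose position partition refines that of `x`. -/
noncomputable def localProj {n N : ℕ} (y : Fin n → Fin N) (ℓ : ℝ) (f : (Fin n → Fin N) → ℝ)
    (x : Fin n → Fin N) : ℝ :=
  (∑ z ∈ (localNbhd y ℓ).filter (fun z => positionPartition z ≤ positionPartition x),
      weight z * f z) /
    ∑ z ∈ (localNbhd y ℓ).filter (fun z => positionPartition z ≤ positionPartition x), weight z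

/-- Subquadratic decay of the coefficients with rate `υ`. -/
def SubquadraticDecay {N : ℕ} (c : Fin N → Fin N → ℝ) (υ : ℝ) : Prop :=
  ∀ i j : Fin N, i < j → c i j > υ * |(i : ℝ) - (j : ℝ)| ^ (-2 : ℤ)

/-! Jumps and swaps of two distinct particles between equivalent sites preserve the local
neighborhood. Hence `localProj` and `localDirichlet` depend on `f` only through its restriction
to the local neighborhood, and functions on the local neighborhood may be represented by
functions on all of `[N]ⁿ`. -/

theorem swap_eq_comp {n N : ℕ} {a b : Fin n} {i j : Fin N} {x : Fin n → Fin N}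
    (h : x a = i ∧ x b = j) : swap a b i j x = x ∘ Equiv.swap a b := by
  funext c
  simp only [swap, h, and_self, if_true, Function.comp, Equiv.swap_apply_def]
  split_ifs <;> simp [h]

theorem swap_mem_evenConfigs {n N : ℕ} {a b : Fin n} {i j : Fin N} {x : Fin n → Fin N}
    (hx : x ∈ evenConfigs n N) : swap a b i j x ∈ evenConfigs n N := by
  by_cases h : x a = i ∧ x b = j
  · rw [swap_eq_comp h]
    simp only [evenConfigs, Finset.mem_filter, Finset.mem_univ, true_and] at hx ⊢
    intro k
    have : particleNumber k (x ∘ Equiv.swap a b) = particleNumber k x := by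
      unfold particleNumber
      refine Finset.card_bij (fun c _ => Equiv.swap a b c) ?_ ?_ ?_
      · intro c hc; simpa using hc
      · intro c _ d _ hcd; exact (Equiv.swap a b).injective hcd
      · intro c hc; exact ⟨Equiv.swap a b c, by simpa using hc, by simp⟩
    rw [this]; exact hx k
  · have : swap a b i j x = x := by funext c; simp [swap, h]
    rwa [this]

theorem jump_mem_evenConfigs {n N : ℕ} {a b : Fin n} (hab : a ≠ b) {i j : Fin N}
    {x : Fin n → Fin N} (hx : x ∈ evenConfigs n N) : jump a b i j x ∈ evenConfigs n N := by
  by_cases h : x a = i ∧ x b = i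
  · simp only [evenConfigs, Finset.mem_filter, Finset.mem_univ, true_and] at hx ⊢
    intro k
    -- away from `a` and `b` nothing changes, and `a`, `b` move together
    have key : ∀ z : Fin n → Fin N, z a = z b →
        (Even (particleNumber k z) ↔
          Even ((Finset.univ.filter fun c => z c = k ∧ c ≠ a ∧ c ≠ b).card)) := by
      intro z hz
      unfold particleNumber
      by_cases hk : z a = k
      · have : (Finset.univ.filter fun c => z c = k) =
            insert a (insert b (Finset.univ.filter fun c => z c = k ∧ c ≠ a ∧ c ≠ b)) := by
          ext c
          simp only [Finset.mem_filter, Finset.mem_univ, true_and, Finset.mem_insert]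
          by_cases hca : c = a
          · subst hca; simp [hk]
          · by_cases hcb : c = b
            · subst hcb; simp [← hz, hk]
            · simp [hca, hcb]
        rw [this, Finset.card_insert_of_notMem (by simp [hab]),
          Finset.card_insert_of_notMem (by simp)]
        simp [Nat.even_add_one]
      · have : (Finset.univ.filter fun c => z c = k) =
            Finset.univ.filter fun c => z c = k ∧ c ≠ a ∧ c ≠ b := by
          ext c
          simp only [Finset.mem_filter, Finset.mem_univ, true_and]
          constructor
          · intro hc
            refine ⟨hc, ?_, ?_⟩
            · rintro rfl; exact hk hc
            · rintro rfl; exact hk (hz.trans hc)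
          · exact fun hc => hc.1
        rw [this]
    rw [key _ (by simp [jump, h])]
    have hk := (key x (h.1.trans h.2.symm)).1 (hx k)
    convert hk using 2
    ext c
    simp only [Finset.mem_filter, Finset.mem_univ, true_and, jump, h, and_self, and_true]
    constructor
    · rintro ⟨h1, h2, h3⟩; simp [h2, h3] at h1; exact ⟨h1, h2, h3⟩
    · rintro ⟨h1, h2, h3⟩; simp [h1, h2, h3]
  · have : jump a b i j x = x := by funext c; simp [jump, h]
    rwa [this]

theorem jump_mem_localNbhd {n N : ℕ} {y : Fin n → Fin N} {ℓ : ℝ} {a b : Fin n} (hab : a ≠ b)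
    {i j : Fin N} (hij : localRel y ℓ i j) {x : Fin n → Fin N} (hx : x ∈ localNbhd y ℓ) :
    jump a b i j x ∈ localNbhd y ℓ := by
  simp only [localNbhd, Finset.mem_filter] at hx ⊢
  refine ⟨jump_mem_evenConfigs hab hx.1, fun c => ?_⟩
  unfold jump
  split_ifs with h
  · have hc : x c = i := by rcases h with ⟨rfl | rfl, h1, h2⟩ <;> assumption
    exact (Relation.EqvGen.symm _ _ hij).trans _ _ _ (hc ▸ hx.2 c)
  · exact hx.2 c

theorem swap_mem_localNbhd {n N : ℕ} {y : Fin n → Fin N} {ℓ : ℝ} {a b : Fin n}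
    {i j : Fin N} (hij : localRel y ℓ i j) {x : Fin n → Fin N} (hx : x ∈ localNbhd y ℓ) :
    swap a b i j x ∈ localNbhd y ℓ := by
  simp only [localNbhd, Finset.mem_filter] at hx ⊢
  refine ⟨swap_mem_evenConfigs hx.1, fun c => ?_⟩
  unfold swap
  split_ifs with h h1 h2
  · subst h1; exact (Relation.EqvGen.symm _ _ hij).trans _ _ _ (h.1 ▸ hx.2 c)
  · subst h2; exact hij.trans _ _ _ (h.2 ▸ hx.2 c)
  · exact hx.2 c
  · exact hx.2 c

end ColoredFlow

/-! Multiplication by M(x) = ∏ nᵢ(x)!!, the square root of π, turns functions into tensors in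
(ℝ^N)^{⊗n} and turns 𝓛_ij into the square of the infinitesimal rotation E_ij - E_ji, acting as a
derivation on all factors (`rot_rot_localTensor`). So D(f) is the sum of c_ij ‖(E_ij - E_ji)F‖² over
equivalent pairs. The classes of ∼ are intervals, and one with m > 1 sites has m ≤ 3(n+1)ℓ; hence
1/m is at most a constant times (ℓ/υ) c_ij (`avg_siteClass_le`). It remains to treat the mean-field
operator with coefficients 1/m, the Casimir operator of a product of orthogonal groups, one for each
class.

Gap: the Casimir operator is a gl-type part minus the contractions of pairs of labels
(`casimir_eq_sub`), and contracting a and b intertwines it with the Casimir operator on the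
remaining labels (`contract_mul_casimir`). An eigenvector either has a nonzero contraction, with the
same eigenvalue and two labels fewer, or is traceless, and then only the gl part acts. On tensors
with even occupation numbers the gl part is at least 1/2 (`half_le_glPart`), so every nonzero
eigenvalue is at least 1/2, uniformly in the class sizes.

Kernel: the same induction shows that the kernel is spanned by the tensors of perfect matchings of
labels (`mem_pairSpan_of_casimir_eq_zero`), a form of the first fundamental theorem for orthogonal
groups.

Projection: M(x) counts the perfect matchings that pair labels at equal sites (`card_matchingsOn`).
Conjugating matchings shows that P fixes every kernel tensor divided by M
(`pairTensor_mul_sum_weight`). P need not be the orthogonal projection onto the kernel; it suffices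
that it fixes the kernel and is bounded on ℓ²(π) by a constant depending on n only
(`sum_weight_mul_localProj_sq_le`). -/

namespace ColoredFlow

/-! ### Matrix units and infinitesimal rotations on tensor factors -/

section Hop

variable {A I : Type*} [Fintype A] [DecidableEq A] [Fintype I] [DecidableEq I]

/-- The matrix unit `E_{ij}` acting on the tensor factor with label `a`. -/
def hop (a : A) (i j : I) : Module.End ℝ ((A → I) → ℝ) where
  toFun F x := if x a = i then F (Function.update x a j) else 0
  map_add' F G := by ext x; by_cases h : x a = i <;> simp [h]
  map_smul' r F := by ext x; by_cases h : x a = i <;> simp [h]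

omit [Fintype A] [Fintype I] in
theorem hop_apply (a : A) (i j : I) (F : (A → I) → ℝ) (x : A → I) :
    hop a i j F x = if x a = i then F (Function.update x a j) else 0 := rfl

omit [Fintype A] [Fintype I] in
theorem hop_mul_self (a : A) (i j k l : I) :
    hop a i j * hop a k l = if j = k then hop a i l else 0 := by
  ext F x
  by_cases h : j = k
  · simp [hop_apply, h]
  · simp [hop_apply, h]

omit [Fintype A] [Fintype I] in
theorem hop_mul_comm {a b : A} (hab : a ≠ b) (i j k l : I) :
    hop a i j * hop b k l = hop b k l * hop a i j := by
  ext F x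
  simp only [Module.End.mul_apply, hop_apply, Function.update_of_ne hab,
    Function.update_of_ne hab.symm, Function.update_comm hab]
  split_ifs <;> rfl

theorem sum_hop_mul (a : A) (i j : I) (F G : (A → I) → ℝ) :
    ∑ x, hop a i j F x * G x = ∑ x, F x * hop a j i G x := by
  simp only [hop_apply, ite_mul, mul_ite, zero_mul, mul_zero, ← Finset.sum_filter]
  refine Finset.sum_nbij' (fun x => Function.update x a j) (fun x => Function.update x a i)
    ?_ ?_ ?_ ?_ ?_
  · intro x _; simp
  · intro x _; simp
  · intro x hx; simp only [Finset.mem_filter] at hx; simp [← hx.2]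
  · intro x hx; simp only [Finset.mem_filter] at hx; simp [← hx.2]
  · intro x hx; simp only [Finset.mem_filter] at hx; simp [← hx.2]

omit [Fintype A] in
theorem sum_hop_self (a : A) : ∑ i : I, hop a i i = 1 := by
  ext F x
  simp [hop_apply, LinearMap.sum_apply]

/-- The matrix unit `E_{ij}` acting as a derivation on the tensor factors in `S`. -/
def shift (S : Finset A) (i j : I) : Module.End ℝ ((A → I) → ℝ) := ∑ a ∈ S, hop a i j

theorem sum_shift_mul (S : Finset A) (i j : I) (F G : (A → I) → ℝ) :
    ∑ x, shift S i j F x * G x = ∑ x, F x * shift S j i G x := by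
  simp only [shift, LinearMap.sum_apply, Finset.sum_apply, Finset.sum_mul, Finset.mul_sum]
  rw [Finset.sum_comm, Finset.sum_congr rfl fun a _ => sum_hop_mul a i j F G, Finset.sum_comm]

/-- The infinitesimal rotation in the `(i, j)` plane, acting on the tensor factors in `S`. -/
def rot (S : Finset A) (i j : I) : Module.End ℝ ((A → I) → ℝ) := shift S i j - shift S j i

theorem sum_rot_mul (S : Finset A) (i j : I) (F G : (A → I) → ℝ) :
    ∑ x, rot S i j F x * G x = -∑ x, F x * rot S i j G x := by
  simp only [rot, LinearMap.sub_apply, Pi.sub_apply, sub_mul, mul_sub, Finset.sum_sub_distrib,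
    sum_shift_mul]
  ring

omit [Fintype A] [Fintype I] in
theorem rot_eq_add {S : Finset A} {a b : A} (ha : a ∈ S) (hb : b ∈ S) (hab : a ≠ b) (i j : I) :
    rot S i j = (hop a i j - hop a j i) + (hop b i j - hop b j i) +
      rot ((S.erase a).erase b) i j := by
  have key : ∀ k l : I, shift S k l = hop a k l + hop b k l + shift ((S.erase a).erase b) k l := by
    intro k l
    unfold shift
    rw [← Finset.add_sum_erase S _ ha,
      ← Finset.add_sum_erase (S.erase a) _ (Finset.mem_erase.2 ⟨hab.symm, hb⟩), add_assoc]
  rw [rot, rot, key, key]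
  abel

end Hop

/-! ### The class-averaged Casimir operator and its contractions -/

section Casimir

variable {A I Q : Type*} [Fintype A] [DecidableEq A] [Fintype I] [DecidableEq I] [DecidableEq Q]

/-- The kernel of the averaging over the classes of sites given by the fibres of `κ`. -/
noncomputable def avg (κ : I → Q) (i j : I) : ℝ :=
  if κ i = κ j then ((Finset.univ.filter fun k => κ k = κ i).card : ℝ)⁻¹ else 0

omit [DecidableEq I] in
theorem avg_comm (κ : I → Q) (i j : I) : avg κ i j = avg κ j i := by
  unfold avg
  by_cases h : κ i = κ j
  · simp [h]
  · simp [h, Ne.symm h]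

omit [DecidableEq I] in
theorem avg_nonneg (κ : I → Q) (i j : I) : 0 ≤ avg κ i j := by
  unfold avg; split_ifs <;> positivity

omit [DecidableEq I] in
theorem avg_congr {κ : I → Q} {i j k l : I} (hi : κ i = κ k) (hj : κ j = κ l) :
    avg κ i j = avg κ k l := by
  simp [avg, hi, hj]

omit [DecidableEq I] in
theorem avg_le_self (κ : I → Q) (i j : I) : avg κ i j ≤ avg κ i i := by
  unfold avg
  split_ifs with h h'
  · rfl
  · exact absurd rfl h'
  · positivity
  · rfl

omit [DecidableEq I] in
theorem class_eq_of_avg_ne {κ : I → Q} {i j : I} (h : avg κ i j ≠ 0) : κ i = κ j := by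
  by_contra h'
  exact h (by simp [avg, h'])

omit [DecidableEq I] in
theorem sum_avg (κ : I → Q) (i : I) : ∑ j, avg κ i j = 1 := by
  unfold avg
  rw [← Finset.sum_filter, Finset.sum_const, nsmul_eq_mul,
    Finset.filter_congr (fun k _ => eq_comm (a := κ i))]
  refine mul_inv_cancel₀ ?_
  have : 0 < (Finset.univ.filter fun k => κ k = κ i).card :=
    Finset.card_pos.2 ⟨i, by simp⟩
  positivity

/-- The Casimir operator, summed over the classes of `κ` with the inverse class sizes as
weights. -/
noncomputable def casimir (κ : I → Q) (S : Finset A) : Module.End ℝ ((A → I) → ℝ) :=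
  (-1 / 2 : ℝ) • ∑ i, ∑ j, avg κ i j • (rot S i j * rot S i j)

/-- The weighted contraction of the labels `a` and `b` against the invariant form. -/
noncomputable def contract (κ : I → Q) (a b : A) : Module.End ℝ ((A → I) → ℝ) :=
  ∑ i, ∑ j, avg κ i j • (hop a i j * hop b i j)

/-- The weighted exchange of the labels `a` and `b`. -/
noncomputable def exchange (κ : I → Q) (a b : A) : Module.End ℝ ((A → I) → ℝ) :=
  ∑ i, ∑ j, avg κ i j • (hop a j i * hop b i j)

/-- Multiplication by the inverse size of the class of the label `a`. -/
noncomputable def classInv (κ : I → Q) (a : A) : Module.End ℝ ((A → I) → ℝ) :=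
  ∑ i, avg κ i i • hop a i i

/-- The Casimir operator without its contraction part. -/
noncomputable def glPart (κ : I → Q) (S : Finset A) : Module.End ℝ ((A → I) → ℝ) :=
  ∑ a ∈ S, (1 - classInv κ a + ∑ b ∈ S.erase a, exchange κ a b)

omit [Fintype A] in
theorem exchange_apply (κ : I → Q) {a b : A} (hab : a ≠ b) (F : (A → I) → ℝ) (x : A → I) :
    exchange κ a b F x = avg κ (x a) (x b) * F (x ∘ Equiv.swap a b) := by
  have h : Function.update (Function.update x a (x b)) b (x a) = x ∘ Equiv.swap a b := by
    funext c
    simp only [Function.comp, Equiv.swap_apply_def, Function.update_apply]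
    split_ifs with h1 h2 <;> simp_all
  simp only [exchange, LinearMap.sum_apply, Finset.sum_apply, LinearMap.smul_apply,
    Pi.smul_apply, Module.End.mul_apply, hop_apply, Function.update_of_ne hab.symm, smul_eq_mul,
    mul_ite, mul_zero]
  simp [h, avg_comm κ (x b)]

omit [Fintype A] in
theorem contract_apply (κ : I → Q) {a b : A} (hab : a ≠ b) (F : (A → I) → ℝ) (x : A → I) :
    contract κ a b F x = if x a = x b then
      ∑ k, avg κ (x a) k * F (Function.update (Function.update x a k) b k) else 0 := by
  simp only [contract, LinearMap.sum_apply, Finset.sum_apply, LinearMap.smul_apply,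
    Pi.smul_apply, Module.End.mul_apply, hop_apply, Function.update_of_ne hab.symm, smul_eq_mul,
    mul_ite, mul_zero]
  rw [Finset.sum_comm]
  by_cases h : x a = x b
  · simp [h]
  · simp [Ne.symm h, h]

omit [Fintype A] in
theorem classInv_apply (κ : I → Q) (a : A) (F : (A → I) → ℝ) (x : A → I) :
    classInv κ a F x = avg κ (x a) (x a) * F x := by
  simp [classInv, LinearMap.sum_apply, hop_apply]

-- For a = b the product is E_jj, and averaging over i gives the identity because the rows of `avg`
-- sum to 1; the pairs a ≠ b give exchanges.
omit [Fintype A] in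
theorem sum_shift_mul_shift (κ : I → Q) (S : Finset A) :
    ∑ i, ∑ j, avg κ i j • (shift S j i * shift S i j) =
      ∑ a ∈ S, (1 + ∑ b ∈ S.erase a, exchange κ a b) := by
  have h : ∀ i j : I, shift S j i * shift S i j =
      ∑ a ∈ S, (hop a j j + ∑ b ∈ S.erase a, hop a j i * hop b i j) := by
    intro i j
    rw [shift, shift, Finset.sum_mul_sum]
    refine Finset.sum_congr rfl fun a ha => ?_
    rw [← Finset.add_sum_erase S _ ha, hop_mul_self, if_pos rfl]
  simp only [h, Finset.smul_sum, smul_add, Finset.sum_add_distrib]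
  congr 1
  · rw [Finset.sum_comm' (t' := Finset.univ) (s' := fun _ => Finset.univ) (by simp)]
    have : ∀ j : I, ∑ i, ∑ a ∈ S, avg κ i j • hop a j j = ∑ a ∈ S, hop a j j := by
      intro j
      rw [Finset.sum_comm]
      refine Finset.sum_congr rfl fun a _ => ?_
      rw [← Finset.sum_smul]
      simp [avg_comm κ _ j, sum_avg]
    rw [Finset.sum_congr rfl fun j _ => this j, Finset.sum_comm]
    exact Finset.sum_congr rfl fun a _ => sum_hop_self a
  · unfold exchange
    rw [Finset.sum_congr rfl fun i _ => Finset.sum_comm, Finset.sum_comm]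
    refine Finset.sum_congr rfl fun a _ => ?_
    rw [Finset.sum_congr rfl fun i _ => Finset.sum_comm, Finset.sum_comm]

-- For a = b the product E_ij E_ij survives only when i = j, which leaves the inverse class size;
-- the pairs a ≠ b give contractions.
omit [Fintype A] in
theorem sum_shift_sq (κ : I → Q) (S : Finset A) :
    ∑ i, ∑ j, avg κ i j • (shift S i j * shift S i j) =
      ∑ a ∈ S, (classInv κ a + ∑ b ∈ S.erase a, contract κ a b) := by
  have h : ∀ i j : I, shift S i j * shift S i j =
      ∑ a ∈ S, ((if j = i then hop a i j else 0) + ∑ b ∈ S.erase a, hop a i j * hop b i j) := by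
    intro i j
    rw [shift, Finset.sum_mul_sum]
    refine Finset.sum_congr rfl fun a ha => ?_
    rw [← Finset.add_sum_erase S _ ha, hop_mul_self]
  simp only [h, Finset.smul_sum, smul_add, Finset.sum_add_distrib]
  congr 1
  · unfold classInv
    rw [Finset.sum_congr rfl fun i _ => Finset.sum_comm, Finset.sum_comm]
    simp
  · unfold contract
    rw [Finset.sum_congr rfl fun i _ => Finset.sum_comm, Finset.sum_comm]
    refine Finset.sum_congr rfl fun a _ => ?_
    rw [Finset.sum_congr rfl fun i _ => Finset.sum_comm, Finset.sum_comm]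

-- Expand (E_ij - E_ji)² and use the symmetry of `avg` to rename i and j. The inverse class sizes
-- from the square terms end up in `glPart`.
omit [Fintype A] in
theorem casimir_eq_sub (κ : I → Q) (S : Finset A) :
    casimir κ S = glPart κ S - ∑ a ∈ S, ∑ b ∈ S.erase a, contract κ a b := by
  have hsymm : ∀ T : I → I → Module.End ℝ ((A → I) → ℝ),
      ∑ i, ∑ j, avg κ i j • T j i = ∑ i, ∑ j, avg κ i j • T i j := by
    intro T
    rw [Finset.sum_comm]
    simp only [avg_comm κ]
  have h : ∑ i, ∑ j, avg κ i j • (rot S i j * rot S i j) =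
      (2 : ℝ) • (∑ i, ∑ j, avg κ i j • (shift S i j * shift S i j)) -
      (2 : ℝ) • (∑ i, ∑ j, avg κ i j • (shift S j i * shift S i j)) := by
    have e1 := hsymm fun i j => shift S i j * shift S i j
    have e2 := hsymm fun i j => shift S j i * shift S i j
    simp only [rot, sub_mul, mul_sub, smul_sub, Finset.sum_sub_distrib]
    rw [e1, e2, two_smul, two_smul]
    abel
  rw [casimir, h, sum_shift_mul_shift, sum_shift_sq, glPart, smul_sub, smul_smul, smul_smul]
  simp only [Finset.sum_add_distrib, Finset.sum_sub_distrib]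
  norm_num
  abel

-- Infinitesimal invariance of the form ∑ eᵢ ⊗ eᵢ under rotations. The weights attached to k and l
-- must agree, hence the condition that they share a class.
omit [Fintype A] in
theorem contract_mul_rot_pair (κ : I → Q) {a b : A} (hab : a ≠ b) {k l : I} (hkl : κ k = κ l) :
    contract κ a b * ((hop a k l - hop a l k) + (hop b k l - hop b l k)) = 0 := by
  have hb : ∀ u v : I, contract κ a b * hop b u v =
      ∑ i, avg κ i u • (hop a i u * hop b i v) := by
    intro u v
    simp only [contract, Finset.sum_mul, smul_mul_assoc, mul_assoc, hop_mul_self]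
    simp
  have ha : ∀ u v : I, contract κ a b * hop a u v =
      ∑ i, avg κ i u • (hop a i v * hop b i u) := by
    intro u v
    simp only [contract, Finset.sum_mul, smul_mul_assoc, mul_assoc, ← hop_mul_comm hab]
    simp only [← mul_assoc, hop_mul_self]
    simp
  simp only [mul_add, mul_sub, ha, hb]
  simp only [avg_congr rfl hkl]
  abel

omit [Fintype A] in
theorem contract_mul_hop (κ : I → Q) {a b c : A} (ha : c ≠ a) (hb : c ≠ b) (k l : I) :
    contract κ a b * hop c k l = hop c k l * contract κ a b := by
  simp only [contract, Finset.sum_mul, Finset.mul_sum, smul_mul_assoc, mul_smul_comm]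
  refine Finset.sum_congr rfl fun i _ => Finset.sum_congr rfl fun j _ => ?_
  rw [mul_assoc, ← hop_mul_comm hb, ← mul_assoc, ← hop_mul_comm ha, mul_assoc]

omit [Fintype A] in
theorem contract_mul_rot (κ : I → Q) {S : Finset A} {a b : A} (ha : a ∈ S) (hb : b ∈ S)
    (hab : a ≠ b) {k l : I} (hkl : κ k = κ l) :
    contract κ a b * rot S k l = rot ((S.erase a).erase b) k l * contract κ a b := by
  rw [rot_eq_add ha hb hab, mul_add, contract_mul_rot_pair κ hab hkl, zero_add]
  have : ∀ u v : I, contract κ a b * shift ((S.erase a).erase b) u v =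
      shift ((S.erase a).erase b) u v * contract κ a b := by
    intro u v
    simp only [shift, Finset.mul_sum, Finset.sum_mul]
    refine Finset.sum_congr rfl fun c hc => ?_
    simp only [Finset.mem_erase] at hc
    exact contract_mul_hop κ hc.2.1 hc.1 u v
  rw [rot, mul_sub, sub_mul, this, this]

-- Contraction is equivariant under rotations within a class, and `avg` vanishes between different
-- classes.
omit [Fintype A] in
theorem contract_mul_casimir (κ : I → Q) {S : Finset A} {a b : A} (ha : a ∈ S) (hb : b ∈ S)
    (hab : a ≠ b) :
    contract κ a b * casimir κ S = casimir κ ((S.erase a).erase b) * contract κ a b := by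
  simp only [casimir, mul_smul_comm, smul_mul_assoc, Finset.mul_sum,
    Finset.sum_mul]
  congr 1
  refine Finset.sum_congr rfl fun i _ => Finset.sum_congr rfl fun j _ => ?_
  by_cases h : avg κ i j = 0
  · simp [h]
  · rw [← mul_assoc, contract_mul_rot κ ha hb hab (class_eq_of_avg_ne h), mul_assoc,
      contract_mul_rot κ ha hb hab (class_eq_of_avg_ne h), mul_assoc]

theorem sum_mul_casimir (κ : I → Q) (S : Finset A) (F : (A → I) → ℝ) :
    ∑ x, F x * casimir κ S F x =
      1 / 2 * ∑ i, ∑ j, avg κ i j * ∑ x, (rot S i j F x) ^ 2 := by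
  have h : ∀ i j : I, ∑ x, (rot S i j F x) ^ 2 = -∑ x, F x * rot S i j (rot S i j F) x := by
    intro i j
    rw [← sum_rot_mul]
    exact Finset.sum_congr rfl fun x _ => sq _
  simp only [h, casimir, LinearMap.smul_apply, LinearMap.sum_apply,
    Pi.smul_apply, Finset.sum_apply, Module.End.mul_apply, smul_eq_mul,
    Finset.mul_sum, mul_neg, ← Finset.sum_neg_distrib]
  rw [Finset.sum_comm]
  refine Finset.sum_congr rfl fun i _ => ?_
  rw [Finset.sum_comm]
  refine Finset.sum_congr rfl fun j _ => Finset.sum_congr rfl fun x _ => ?_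
  ring

theorem casimir_symm (κ : I → Q) (S : Finset A) (F G : (A → I) → ℝ) :
    ∑ x, casimir κ S F x * G x = ∑ x, F x * casimir κ S G x := by
  have h : ∀ i j : I, ∑ x, rot S i j (rot S i j F) x * G x =
      ∑ x, F x * rot S i j (rot S i j G) x := by
    intro i j
    rw [sum_rot_mul, sum_rot_mul, neg_neg]
  simp only [casimir, LinearMap.smul_apply, LinearMap.sum_apply,
    Pi.smul_apply, Finset.sum_apply, Module.End.mul_apply, smul_eq_mul,
    Finset.mul_sum, Finset.sum_mul]
  rw [Finset.sum_comm, Finset.sum_comm (s := Finset.univ (α := A → I))]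
  refine Finset.sum_congr rfl fun i _ => ?_
  rw [Finset.sum_comm, Finset.sum_comm (s := Finset.univ (α := A → I))]
  refine Finset.sum_congr rfl fun j _ => ?_
  have := congrArg (fun t => -1 / 2 * (avg κ i j * t)) (h i j)
  simp only [Finset.mul_sum] at this
  convert this using 2 <;> ring

end Casimir

/-! ### Spectral gap of the Casimir operator on even tensors -/

section Gap

variable {A I Q : Type*} [Fintype A] [DecidableEq A] [Fintype I] [DecidableEq I] [DecidableEq Q]

/-- `F` is supported on configurations in which every site carries an even number of labels
from `S`. -/
def EvenOn (S : Finset A) (F : (A → I) → ℝ) : Prop :=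
  ∀ x, F x ≠ 0 → ∀ i, Even (S.filter fun a => x a = i).card

omit [Fintype A] [DecidableEq A] in
theorem sum_card_filter_mul (S : Finset A) (x : A → I) (φ : I → ℝ) :
    ∑ i, φ i * ((S.filter fun a => x a = i).card : ℝ) = ∑ a ∈ S, φ (x a) := by
  simp only [Finset.card_filter, Nat.cast_sum, Finset.mul_sum]
  rw [Finset.sum_comm]
  simp

omit [Fintype A] [Fintype I] in
theorem shift_self_apply (S : Finset A) (i : I) (F : (A → I) → ℝ) (x : A → I) :
    shift S i i F x = ((S.filter fun a => x a = i).card : ℝ) * F x := by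
  simp only [shift, LinearMap.sum_apply, Finset.sum_apply, hop_apply, Finset.card_filter,
    Nat.cast_sum, Finset.sum_mul]
  refine Finset.sum_congr rfl fun a _ => ?_
  by_cases h : x a = i
  · simp [← h]
  · simp [h]

theorem sum_mul_glPart (κ : I → Q) (S : Finset A) (F : (A → I) → ℝ) :
    ∑ x, F x * glPart κ S F x = ∑ i, ∑ j, avg κ i j * ∑ x, (shift S i j F x) ^ 2 -
      ∑ x, F x ^ 2 * ∑ a ∈ S, avg κ (x a) (x a) := by
  have h1 : glPart κ S = ∑ i, ∑ j, avg κ i j • (shift S j i * shift S i j) -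
      ∑ a ∈ S, classInv κ a := by
    rw [sum_shift_mul_shift, glPart, ← Finset.sum_sub_distrib]
    exact Finset.sum_congr rfl fun a _ => by abel
  have h2 : ∀ i j, ∑ x, (shift S i j F x) ^ 2 = ∑ x, F x * shift S j i (shift S i j F) x := by
    intro i j
    rw [← sum_shift_mul]
    exact Finset.sum_congr rfl fun x _ => sq _
  simp only [h1, h2, LinearMap.sub_apply, Pi.sub_apply, mul_sub, Finset.sum_sub_distrib,
    LinearMap.sum_apply, Finset.sum_apply, classInv_apply, LinearMap.smul_apply, Pi.smul_apply,
    Module.End.mul_apply, smul_eq_mul]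
  congr 1
  · simp only [Finset.mul_sum]
    rw [Finset.sum_comm]
    refine Finset.sum_congr rfl fun i _ => ?_
    rw [Finset.sum_comm]
    exact Finset.sum_congr rfl fun j _ => Finset.sum_congr rfl fun x _ => by ring
  · refine Finset.sum_congr rfl fun x _ => ?_
    rw [Finset.mul_sum, Finset.mul_sum]
    exact Finset.sum_congr rfl fun a _ => by ring

/-- Keep only the terms i = j of the nonnegative sum in `sum_mul_glPart`. They contribute nᵢ² ≥ 2nᵢ
for even nᵢ, which is twice the term subtracted. This bound is strong when the classes are small. -/
theorem glPart_ge_of_even (κ : I → Q) {S : Finset A} {F : (A → I) → ℝ} (hF : EvenOn S F) :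
    ∑ x, F x ^ 2 * ∑ a ∈ S, avg κ (x a) (x a) ≤ ∑ x, F x * glPart κ S F x := by
  rw [sum_mul_glPart, le_sub_iff_add_le, ← Finset.sum_add_distrib]
  have h1 : ∑ i, avg κ i i * ∑ x, (shift S i i F x) ^ 2 ≤
      ∑ i, ∑ j, avg κ i j * ∑ x, (shift S i j F x) ^ 2 :=
    Finset.sum_le_sum fun i _ => Finset.single_le_sum
      (f := fun j => avg κ i j * ∑ x, (shift S i j F x) ^ 2)
      (fun j _ => mul_nonneg (avg_nonneg κ i j) (Finset.sum_nonneg fun x _ => sq_nonneg _))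
      (Finset.mem_univ i)
  refine le_trans ?_ h1
  simp only [Finset.mul_sum _ _ (avg κ _ _)]
  rw [Finset.sum_comm]
  refine Finset.sum_le_sum fun x _ => ?_
  rw [← sum_card_filter_mul S x fun i => avg κ i i, Finset.mul_sum, ← Finset.sum_add_distrib]
  refine Finset.sum_le_sum fun i _ => ?_
  rw [shift_self_apply]
  by_cases hx : F x = 0
  · simp [hx]
  obtain ⟨k, hk⟩ := hF x hx i
  have hk2 : 2 * ((S.filter fun a => x a = i).card : ℝ) ≤
      ((S.filter fun a => x a = i).card : ℝ) ^ 2 := by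
    rcases Nat.eq_zero_or_pos k with h | h
    · simp [hk, h]
    · have : (2 : ℝ) ≤ ((S.filter fun a => x a = i).card : ℝ) := by
        rw [hk]; exact_mod_cast (by omega : 2 ≤ k + k)
      nlinarith
  have := mul_le_mul_of_nonneg_left hk2 (mul_nonneg (avg_nonneg κ i i) (sq_nonneg (F x)))
  nlinarith [this]

/-- Apply 2uv ≥ -u² - v² to F and its relabelling; the weight is invariant under the relabelling. -/
theorem sum_mul_exchange_ge (κ : I → Q) {a b : A} (hab : a ≠ b) (F : (A → I) → ℝ) :
    -∑ x, F x ^ 2 * avg κ (x a) (x a) ≤ ∑ x, F x * exchange κ a b F x := by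
  have h1 : ∑ x : A → I, avg κ (x a) (x b) * F (x ∘ Equiv.swap a b) ^ 2 =
      ∑ x : A → I, avg κ (x a) (x b) * F x ^ 2 := by
    refine Fintype.sum_equiv ((Equiv.swap a b).arrowCongr (Equiv.refl I)) _ _ fun x => ?_
    simp [avg_comm κ (x b)]
    left; rfl
  have h2 : ∀ x : A → I, -(1 / 2 * (avg κ (x a) (x b) * F x ^ 2) +
      1 / 2 * (avg κ (x a) (x b) * F (x ∘ Equiv.swap a b) ^ 2)) ≤ F x * exchange κ a b F x := by
    intro x
    rw [exchange_apply κ hab]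
    nlinarith [mul_nonneg (avg_nonneg κ (x a) (x b))
      (sq_nonneg (F x + F (x ∘ Equiv.swap a b)))]
  have h3 := Finset.sum_le_sum fun x (_ : x ∈ Finset.univ) => h2 x
  rw [Finset.sum_neg_distrib, Finset.sum_add_distrib, ← Finset.mul_sum, ← Finset.mul_sum, h1]
    at h3
  have h4 : ∑ x : A → I, avg κ (x a) (x b) * F x ^ 2 ≤ ∑ x : A → I, F x ^ 2 * avg κ (x a) (x a) :=
    Finset.sum_le_sum fun x _ => by
      rw [mul_comm]
      exact mul_le_mul_of_nonneg_left (avg_le_self κ _ _) (sq_nonneg _)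
  linarith

/-- Each label loses one inverse class size from `classInv` and at most one from each of its |S| - 1
exchanges. This bound is strong when the classes are large. -/
theorem glPart_ge_sub (κ : I → Q) (S : Finset A) (F : (A → I) → ℝ) :
    ∑ x, F x ^ 2 * ∑ a ∈ S, (1 - S.card * avg κ (x a) (x a)) ≤
      ∑ x, F x * glPart κ S F x := by
  simp only [glPart, LinearMap.sum_apply, LinearMap.add_apply, LinearMap.sub_apply,
    Module.End.one_apply, Finset.sum_apply, Pi.add_apply, Pi.sub_apply, classInv_apply,
    Finset.mul_sum]
  rw [Finset.sum_comm, Finset.sum_comm (t := S)]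
  refine Finset.sum_le_sum fun a ha => ?_
  simp only [mul_add, Finset.mul_sum, Finset.sum_add_distrib]
  rw [Finset.sum_comm (t := S.erase a)]
  have h := Finset.sum_le_sum fun b (hb : b ∈ S.erase a) =>
    sum_mul_exchange_ge κ (Finset.ne_of_mem_erase hb).symm F
  rw [Finset.sum_const, nsmul_eq_mul, Finset.card_erase_of_mem ha, Nat.cast_sub
    (Finset.card_pos.2 ⟨a, ha⟩), Nat.cast_one] at h
  refine le_trans (le_of_eq ?_) (add_le_add_right h _)
  rw [mul_neg, ← sub_eq_add_neg, Finset.mul_sum, ← Finset.sum_sub_distrib]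
  exact Finset.sum_congr rfl fun x _ => by ring

/-- Adding |S| times the small-class bound to the large-class bound cancels the inverse class sizes
and gives the lower bound |S|/(|S|+1) ≥ 1/2. -/
theorem half_le_glPart (κ : I → Q) {S : Finset A} (hS : S.Nonempty) {F : (A → I) → ℝ}
    (hF : EvenOn S F) : 1 / 2 * ∑ x, F x ^ 2 ≤ ∑ x, F x * glPart κ S F x := by
  have h1 := glPart_ge_of_even κ hF
  have h2 := glPart_ge_sub κ S F
  have hn : (1 : ℝ) ≤ S.card := by exact_mod_cast hS.card_pos
  have h3 : ∑ x, F x ^ 2 * ∑ a ∈ S, (1 - S.card * avg κ (x a) (x a)) +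
      S.card * ∑ x, F x ^ 2 * ∑ a ∈ S, avg κ (x a) (x a) = S.card * ∑ x, F x ^ 2 := by
    rw [Finset.mul_sum, Finset.mul_sum, ← Finset.sum_add_distrib]
    refine Finset.sum_congr rfl fun x _ => ?_
    rw [Finset.sum_sub_distrib, ← Finset.mul_sum, Finset.sum_const, nsmul_eq_mul]
    ring
  have h4 : 0 ≤ ∑ x, F x ^ 2 := Finset.sum_nonneg fun x _ => sq_nonneg _
  have h5 : (S.card : ℝ) * ∑ x, F x ^ 2 ≤ (S.card + 1) * ∑ x, F x * glPart κ S F x := by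
    nlinarith
  have h6 : 0 ≤ ∑ x, F x * glPart κ S F x := by nlinarith
  nlinarith

omit [Fintype A] [Fintype I] in
theorem card_filter_update_pair {S : Finset A} {a b : A} (ha : a ∈ S) (hb : b ∈ S)
    (hab : a ≠ b) (x : A → I) (i k : I) :
    (S.filter fun c => Function.update (Function.update x a k) b k c = i).card =
      (((S.erase a).erase b).filter fun c => x c = i).card + if k = i then 2 else 0 := by
  have hb' : b ∈ S.erase a := Finset.mem_erase.2 ⟨hab.symm, hb⟩
  have h : ∀ c ∈ (S.erase a).erase b, (Function.update (Function.update x a k) b k c = i) ↔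
      x c = i := by
    intro c hc
    simp only [Finset.mem_erase] at hc
    rw [Function.update_of_ne hc.1, Function.update_of_ne hc.2.1]
  rw [Finset.card_filter, ← Finset.add_sum_erase S _ ha, ← Finset.add_sum_erase _ _ hb',
    ← Finset.card_filter, Finset.filter_congr h]
  simp only [Function.update_self, Function.update_of_ne hab]
  split_ifs <;> omega

omit [Fintype A] in
theorem EvenOn.contract {κ : I → Q} {S : Finset A} {a b : A} (ha : a ∈ S) (hb : b ∈ S)
    (hab : a ≠ b) {F : (A → I) → ℝ} (hF : EvenOn S F) :
    EvenOn ((S.erase a).erase b) (contract κ a b F) := by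
  intro x hx i
  rw [contract_apply κ hab] at hx
  have hx' : ∑ k, avg κ (x a) k * F (Function.update (Function.update x a k) b k) ≠ 0 := by
    intro h; simp [h] at hx
  obtain ⟨k, -, hk⟩ := Finset.exists_ne_zero_of_sum_ne_zero hx'
  have := hF _ (right_ne_zero_of_mul hk) i
  rw [card_filter_update_pair ha hb hab] at this
  split_ifs at this
  · exact (Nat.even_add.1 this).2 even_two
  · simpa using this

/-- Induction on the number of labels: a nonzero contraction is an eigenvector with the same
eigenvalue on two labels fewer, and without one the gl part alone acts. The eigenvalue cannot reach
the empty label set, where the Casimir operator is 0. -/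
theorem half_le_eigenvalue (κ : I → Q) {μ : ℝ} (hμ : μ ≠ 0) (S : Finset A)
    {F : (A → I) → ℝ} (hF : EvenOn S F) (hF0 : F ≠ 0) (h : casimir κ S F = μ • F) :
    1 / 2 ≤ μ := by
  induction hn : S.card using Nat.strong_induction_on generalizing S F with
  | _ n ih =>
    subst hn
    rcases S.eq_empty_or_nonempty with rfl | hS
    · simp only [casimir_eq_sub, glPart, Finset.sum_empty, sub_zero, LinearMap.zero_apply] at h
      exact absurd h.symm (smul_ne_zero hμ hF0)
    by_cases hc : ∃ a ∈ S, ∃ b ∈ S, a ≠ b ∧ contract κ a b F ≠ 0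
    · obtain ⟨a, ha, b, hb, hab, h0⟩ := hc
      refine ih _ ?_ ((S.erase a).erase b) (hF.contract ha hb hab) h0 ?_ rfl
      · exact (Finset.card_le_card (Finset.erase_subset _ _)).trans_lt
          (Finset.card_erase_lt_of_mem ha)
      · rw [← Module.End.mul_apply, ← contract_mul_casimir κ ha hb hab, Module.End.mul_apply, h,
          map_smul]
    · push Not at hc
      have h1 : glPart κ S F = μ • F := by
        rw [← h, casimir_eq_sub, LinearMap.sub_apply, LinearMap.sum_apply,
          Finset.sum_eq_zero, sub_zero]
        intro a ha
        rw [LinearMap.sum_apply]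
        refine Finset.sum_eq_zero fun b hb => ?_
        rw [Finset.mem_erase] at hb
        exact hc a ha b hb.2 hb.1.symm
      have h2 := half_le_glPart κ hS hF
      have h3 : ∑ x, F x * glPart κ S F x = μ * ∑ x, F x ^ 2 := by
        rw [h1, Finset.mul_sum]
        exact Finset.sum_congr rfl fun x _ => by simp only [Pi.smul_apply, smul_eq_mul]; ring
      have h4 : 0 < ∑ x, F x ^ 2 := by
        obtain ⟨x, hx⟩ := Function.ne_iff.1 hF0
        exact Finset.sum_pos' (fun x _ => sq_nonneg _) ⟨x, Finset.mem_univ _, by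
          have : F x ≠ 0 := hx
          positivity⟩
      rw [h3] at h2
      exact le_of_mul_le_mul_right h2 h4

end Gap

/-! ### The kernel of the Casimir operator is spanned by matchings -/

section Kernel

variable {A I Q : Type*} [DecidableEq A] [Fintype A] [Fintype I] [DecidableEq I] [DecidableEq Q]

/-- A perfect matching of the labels, as a fixed point free involution. -/
def IsMatching (τ : Equiv.Perm A) : Prop := τ * τ = 1 ∧ ∀ a, τ a ≠ a

/-- The invariant tensor of a perfect matching, restricted to the configurations whose classes
agree with those of `y`. -/
def pairTensor (κ : I → Q) (y : A → I) (τ : Equiv.Perm A) (x : A → I) : ℝ :=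
  if x ∘ τ = x ∧ ∀ a, κ (x a) = κ (y a) then 1 else 0

/-- The span of the invariant tensors of the perfect matchings that agree with `ρ` off `S`. -/
def pairSpan (κ : I → Q) (y : A → I) (S : Finset A) (ρ : Equiv.Perm A) :
    Submodule ℝ ((A → I) → ℝ) :=
  Submodule.span ℝ {F | ∃ τ, IsMatching τ ∧ (∀ a ∉ S, τ a = ρ a) ∧ F = pairTensor κ y τ}

omit [DecidableEq A] [Fintype A] in
theorem even_card_of_involution {S : Finset A} {τ : Equiv.Perm A} (hτ : τ * τ = 1)
    (hfix : ∀ a ∈ S, τ a ≠ a) (hS : ∀ a ∈ S, τ a ∈ S) : Even S.card := by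
  have h := Finset.sum_involution (s := S) (f := fun _ => (1 : ZMod 2)) (fun a _ => τ a)
    (fun a _ => by decide) (fun a ha _ => hfix a ha) hS
    (fun a _ => by simpa using Equiv.congr_fun hτ a)
  simpa [ZMod.natCast_eq_zero_iff_even] using h

-- Since the fixed points of ρ are exactly S, a matching that agrees with ρ off S maps S to itself.
-- It pairs the labels of S at each site, so their number is even.
omit [Fintype I] in
theorem evenOn_of_mem_pairSpan {κ : I → Q} {y : A → I} {S : Finset A} {ρ : Equiv.Perm A}
    (hρ : ∀ a, ρ a = a ↔ a ∈ S) {F : (A → I) → ℝ}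
    (hF : F ∈ pairSpan κ y S ρ) : EvenOn S F := by
  have hρS : ∀ a ∉ S, ρ a ∉ S := fun a ha h => ha ((hρ a).1 (ρ.injective ((hρ _).2 h)))
  induction hF using Submodule.span_induction with
  | mem F hF =>
    obtain ⟨τ, hτ, hτρ, rfl⟩ := hF
    intro x hx i
    have hx' : x ∘ τ = x := by
      by_contra h
      exact hx (by simp [pairTensor, h])
    have hinv : ∀ a, τ (τ a) = a := fun a => by simpa using Equiv.congr_fun hτ.1 a
    refine even_card_of_involution hτ.1 (fun a _ => hτ.2 a) fun a ha => ?_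
    rw [Finset.mem_filter] at ha ⊢
    refine ⟨?_, (congrFun hx' a).trans ha.2⟩
    by_contra h
    have h1 := hτρ _ h
    rw [hinv] at h1
    exact hρS _ h (h1 ▸ ha.1)
  | zero => intro x hx; simp at hx
  | add F G _ _ hF hG =>
    intro x hx
    by_cases h : F x = 0
    · exact hG x fun h' => hx (by simp [h, h'])
    · exact hF x h
  | smul r F _ hF => exact fun x hx => hF x (right_ne_zero_of_mul hx)

/-- Exchanging two labels conjugates the matching by their transposition. The weight is constant on
the support because the classes there are prescribed by y. -/
theorem exchange_pairTensor (κ : I → Q) (y : A → I) {a b : A} (hab : a ≠ b)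
    (τ : Equiv.Perm A) :
    exchange κ a b (pairTensor κ y τ) = avg κ (y a) (y b) •
      pairTensor κ y (Equiv.swap a b * τ * Equiv.swap a b) := by
  ext x
  rw [exchange_apply κ hab, Pi.smul_apply, smul_eq_mul]
  have hcomp : (x ∘ Equiv.swap a b) ∘ τ = x ∘ Equiv.swap a b ↔
      x ∘ (Equiv.swap a b * τ * Equiv.swap a b : Equiv.Perm A) = x := by
    constructor
    · intro h
      funext c
      have := congrFun h (Equiv.swap a b c)
      simpa using this
    · intro h
      funext c
      have := congrFun h (Equiv.swap a b c)
      simpa using this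
  by_cases hk : κ (x a) = κ (x b)
  · have hN : ∀ c, κ (x (Equiv.swap a b c)) = κ (x c) := by
      intro c
      rw [Equiv.swap_apply_def]
      split_ifs with h1 h2
      · rw [h1, hk]
      · rw [h2, hk]
      · rfl
    simp only [pairTensor, hcomp, Function.comp_apply, hN]
    split_ifs with h
    · rw [avg_congr (h.2 a) (h.2 b)]
    · simp
  · have h0 : avg κ (x a) (x b) = 0 := by simp [avg, hk]
    rw [h0, zero_mul, pairTensor]
    split_ifs with h
    · rw [← avg_congr (h.2 a) (h.2 b), h0, zero_mul]
    · simp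

theorem glPart_mem_pairSpan (κ : I → Q) (y : A → I) {S : Finset A} {ρ : Equiv.Perm A}
    {F : (A → I) → ℝ} (hρ : ∀ a, ρ a = a ↔ a ∈ S)
    (hF : F ∈ pairSpan κ y S ρ) :
    glPart κ S F ∈ pairSpan κ y S ρ := by
  have hρS : ∀ a ∉ S, ρ a ∉ S := fun a ha h => ha ((hρ a).1 (ρ.injective ((hρ _).2 h)))
  suffices h : pairSpan κ y S ρ ≤ (pairSpan κ y S ρ).comap (glPart κ S) from h hF
  refine Submodule.span_le.2 ?_
  rintro _ ⟨τ, hτ, hτρ, rfl⟩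
  rw [SetLike.mem_coe, Submodule.mem_comap, glPart, LinearMap.sum_apply]
  refine Submodule.sum_mem _ fun a ha => ?_
  have hmem : pairTensor κ y τ ∈ pairSpan κ y S ρ :=
    Submodule.subset_span ⟨τ, hτ, hτρ, rfl⟩
  have hcl : classInv κ a (pairTensor κ y τ) = avg κ (y a) (y a) • pairTensor κ y τ := by
    ext x
    rw [classInv_apply, Pi.smul_apply, smul_eq_mul, pairTensor]
    split_ifs with h
    · rw [avg_congr (h.2 a) (h.2 a)]
    · simp
  rw [LinearMap.add_apply, LinearMap.sub_apply, LinearMap.sum_apply, hcl, Module.End.one_apply]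
  refine Submodule.add_mem _ (Submodule.sub_mem _ hmem (Submodule.smul_mem _ _ hmem)) ?_
  refine Submodule.sum_mem _ fun b hb => ?_
  rw [Finset.mem_erase] at hb
  rw [exchange_pairTensor κ y hb.1.symm]
  refine Submodule.smul_mem _ _ (Submodule.subset_span ⟨_, ⟨?_, ?_⟩, ?_, rfl⟩)
  · have : Equiv.swap a b * τ * Equiv.swap a b * (Equiv.swap a b * τ * Equiv.swap a b) =
      Equiv.swap a b * (τ * (Equiv.swap a b * Equiv.swap a b) * τ) * Equiv.swap a b := by
      group
    rw [this, Equiv.swap_mul_self, mul_one, hτ.1, mul_one, Equiv.swap_mul_self]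
  · intro c h
    refine hτ.2 (Equiv.swap a b c) ?_
    have := congrArg (Equiv.swap a b) h
    simpa using this
  · have hsw : ∀ d ∉ S, Equiv.swap a b d = d := fun d hd =>
      Equiv.swap_apply_of_ne_of_ne (fun h => hd (h ▸ ha)) (fun h => hd (h ▸ hb.2))
    intro c hc
    simp only [Equiv.Perm.mul_apply]
    rw [hsw c hc, hτρ c hc, hsw _ (hρS c hc)]

/-- The lower bound 1/2 makes the gl part injective on even tensors. The span is finite-dimensional,
even and stable, so the gl part is onto there, and injectivity identifies F with its preimage in the
span. -/
theorem mem_pairSpan_of_glPart_mem (κ : I → Q) (y : A → I) {S : Finset A} (hS : S.Nonempty)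
    {ρ : Equiv.Perm A} (hρ : ∀ a, ρ a = a ↔ a ∈ S) {F : (A → I) → ℝ}
    (hF : EvenOn S F) (h : glPart κ S F ∈ pairSpan κ y S ρ) : F ∈ pairSpan κ y S ρ := by
  have hzero : ∀ G : (A → I) → ℝ, EvenOn S G → glPart κ S G = 0 → G = 0 := by
    intro G hG h0
    have h1 := half_le_glPart κ hS hG
    rw [h0] at h1
    simp only [Pi.zero_apply, mul_zero, Finset.sum_const_zero] at h1
    have h2 : ∑ x, G x ^ 2 = 0 :=
      le_antisymm (by linarith) (Finset.sum_nonneg fun x _ => sq_nonneg _)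
    ext x
    have := (Finset.sum_eq_zero_iff_of_nonneg fun x _ => sq_nonneg (G x)).1 h2 x
      (Finset.mem_univ x)
    simpa using this
  let T : pairSpan κ y S ρ →ₗ[ℝ] pairSpan κ y S ρ :=
    (glPart κ S).restrict fun G hG => glPart_mem_pairSpan κ y hρ hG
  have hinj : Function.Injective T := by
    rw [injective_iff_map_eq_zero]
    intro G hG
    exact Subtype.ext (hzero G (evenOn_of_mem_pairSpan hρ G.2) (congrArg Subtype.val hG))
  obtain ⟨G, hG⟩ := LinearMap.injective_iff_surjective.1 hinj ⟨_, h⟩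
  have hG' : glPart κ S G = glPart κ S F := congrArg Subtype.val hG
  have hEG := evenOn_of_mem_pairSpan hρ G.2
  have : F - G = 0 := by
    refine hzero _ (fun x hx => ?_) (by rw [map_sub, hG', sub_self])
    by_cases h : F x = 0
    · exact hEG x fun h' => hx (by simp [h, h'])
    · exact hF x h
  rw [sub_eq_zero.1 this]
  exact G.2

/-- On the kernel the gl part of F equals the sum of its contractions. These lie in the kernel for
two labels fewer, hence in the span by induction, and the gl part can be inverted there. The
permutation ρ records the pairs already contracted: `hsupp` and `hdep` say that F is the indicator
of these pairings and of the classes, times a function of the labels in S. -/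
theorem mem_pairSpan_of_casimir_eq_zero (κ : I → Q) (y : A → I) (S : Finset A)
    (ρ : Equiv.Perm A) (hρ2 : ρ * ρ = 1) (hρ : ∀ a, ρ a = a ↔ a ∈ S) (F : (A → I) → ℝ)
    (hF : EvenOn S F) (hsupp : ∀ x, F x ≠ 0 → x ∘ ρ = x ∧ ∀ a, κ (x a) = κ (y a))
    (hdep : ∀ x z, (x ∘ ρ = x ∧ ∀ a, κ (x a) = κ (y a)) →
      (z ∘ ρ = z ∧ ∀ a, κ (z a) = κ (y a)) → (∀ a ∈ S, x a = z a) → F x = F z)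
    (h : casimir κ S F = 0) : F ∈ pairSpan κ y S ρ := by
  induction hn : S.card using Nat.strong_induction_on generalizing S ρ F with
  | _ n ih =>
    subst hn
    rcases S.eq_empty_or_nonempty with rfl | hS
    · by_cases h0 : F = 0
      · rw [h0]; exact Submodule.zero_mem _
      obtain ⟨x₀, hx₀⟩ := Function.ne_iff.1 h0
      -- With no label left, `hdep` makes F constant on the configurations compatible with ρ and the
      -- classes.
      have : F = F x₀ • pairTensor κ y ρ := by
        ext x
        rw [Pi.smul_apply, smul_eq_mul, pairTensor]
        split_ifs with hx
        · rw [mul_one]; exact hdep _ _ hx (hsupp _ hx₀) (by simp)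
        · rw [mul_zero]; by_contra h'; exact hx (hsupp _ h')
      rw [this]
      refine Submodule.smul_mem _ _ (Submodule.subset_span ⟨ρ, ⟨hρ2, fun a ha => ?_⟩, ?_, rfl⟩)
      · simpa using (hρ a).1 ha
      · simp
    refine mem_pairSpan_of_glPart_mem κ y hS hρ hF ?_
    rw [casimir_eq_sub, LinearMap.sub_apply, sub_eq_zero] at h
    rw [h, LinearMap.sum_apply]
    refine Submodule.sum_mem _ fun a ha => ?_
    rw [LinearMap.sum_apply]
    refine Submodule.sum_mem _ fun b hb => ?_
    rw [Finset.mem_erase] at hb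
    obtain ⟨hba, hb⟩ := hb
    have hab := hba.symm
    have hρa := (hρ a).2 ha
    have hρb := (hρ b).2 hb
    have hcomm : ρ * Equiv.swap a b = Equiv.swap a b * ρ := by
      have := Equiv.swap_apply_apply ρ a b
      rw [hρa, hρb] at this
      rw [eq_mul_inv_iff_mul_eq] at this
      exact this.symm
    have happ : ∀ c, c ≠ a → c ≠ b → (ρ * Equiv.swap a b) c = ρ c := fun c h1 h2 => by
      rw [Equiv.Perm.mul_apply, Equiv.swap_apply_of_ne_of_ne h1 h2]
    have happa : (ρ * Equiv.swap a b) a = b := by simp [hρb]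
    have happb : (ρ * Equiv.swap a b) b = a := by simp [hρa]
    have hcomp : ∀ x : A → I, x ∘ (ρ * Equiv.swap a b : Equiv.Perm A) = x ↔
        x ∘ ρ = x ∧ x a = x b := by
      intro x
      constructor
      · intro hx
        have hxa : x a = x b := by
          have := congrFun hx a
          rw [Function.comp_apply, happa] at this
          exact this.symm
        refine ⟨funext fun c => ?_, hxa⟩
        by_cases h1 : c = a
        · rw [h1, Function.comp_apply, hρa]
        by_cases h2 : c = b
        · rw [h2, Function.comp_apply, hρb]
        have := congrFun hx c
        rwa [Function.comp_apply, happ c h1 h2] at this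
      · rintro ⟨hx, hxa⟩
        funext c
        by_cases h1 : c = a
        · rw [h1, Function.comp_apply, happa, hxa]
        by_cases h2 : c = b
        · rw [h2, Function.comp_apply, happb, hxa]
        rw [Function.comp_apply, happ c h1 h2]
        exact congrFun hx c
    -- Moving a and b together within their class does not affect compatibility, since ρ fixes both;
    -- this carries `hsupp` and `hdep` over to the contraction.
    have hupd : ∀ (x : A → I) (k : I), (κ (x a) = κ k) →
        (κ (x a) = κ (y a)) → (κ (x b) = κ (y b)) → x a = x b →
        ((Function.update (Function.update x a k) b k ∘ ρ =
          Function.update (Function.update x a k) b k ∧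
          ∀ c, κ (Function.update (Function.update x a k) b k c) = κ (y c)) ↔
        (x ∘ ρ = x ∧ ∀ c, κ (x c) = κ (y c))) := by
      intro x k hk hxa hxb hxab
      have hne : ∀ c, c ≠ a → c ≠ b → ρ c ≠ a ∧ ρ c ≠ b := fun c h1 h2 =>
        ⟨fun h => h1 (ρ.injective (h.trans hρa.symm)),
          fun h => h2 (ρ.injective (h.trans hρb.symm))⟩
      constructor
      · rintro ⟨h1, h2⟩
        refine ⟨funext fun c => ?_, fun c => ?_⟩
        · by_cases hca : c = a
          · rw [hca, Function.comp_apply, hρa]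
          by_cases hcb : c = b
          · rw [hcb, Function.comp_apply, hρb]
          have := congrFun h1 c
          simpa [Function.update_apply, hca, hcb, hne c hca hcb] using this
        · by_cases hca : c = a
          · rw [hca, hxa]
          by_cases hcb : c = b
          · rw [hcb, hxb]
          simpa [Function.update_apply, hca, hcb] using h2 c
      · rintro ⟨h1, h2⟩
        refine ⟨funext fun c => ?_, fun c => ?_⟩
        · by_cases hca : c = a
          · rw [hca, Function.comp_apply, hρa]
          by_cases hcb : c = b
          · rw [hcb, Function.comp_apply, hρb]
          have := congrFun h1 c
          simpa [Function.update_apply, hca, hcb, hne c hca hcb] using this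
        · by_cases hcb : c = b
          · rw [hcb, Function.update_self, ← hk, hxab, hxb]
          by_cases hca : c = a
          · rw [hca, Function.update_of_ne hab, Function.update_self, ← hk, hxa]
          simpa [Function.update_apply, hca, hcb] using h2 c
    have hsub : pairSpan κ y ((S.erase a).erase b) (ρ * Equiv.swap a b) ≤ pairSpan κ y S ρ := by
      refine Submodule.span_mono ?_
      rintro _ ⟨τ, hτ, hτρ, rfl⟩
      refine ⟨τ, hτ, fun c hc => ?_, rfl⟩
      rw [hτρ c (by simp [hc]), happ c (fun h => hc (h ▸ ha)) (fun h => hc (h ▸ hb))]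
    refine hsub (ih _ ?_ _ _ ?_ ?_ _ (hF.contract ha hb hab) ?_ ?_ ?_ rfl)
    · exact (Finset.card_le_card (Finset.erase_subset _ _)).trans_lt
        (Finset.card_erase_lt_of_mem ha)
    · nth_rewrite 2 [hcomm]
      rw [mul_assoc, ← mul_assoc (Equiv.swap a b), Equiv.swap_mul_self, one_mul, hρ2]
    · intro c
      by_cases h1 : c = a
      · rw [h1, happa]; simp [hba]
      by_cases h2 : c = b
      · rw [h2, happb]; simp [hab]
      rw [happ c h1 h2, hρ]
      simp [h1, h2]
    · intro x hx
      rw [contract_apply κ hab] at hx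
      have hxab : x a = x b := by by_contra h'; simp [h'] at hx
      rw [if_pos hxab] at hx
      obtain ⟨k, -, hk⟩ := Finset.exists_ne_zero_of_sum_ne_zero hx
      have hk1 := class_eq_of_avg_ne (left_ne_zero_of_mul hk)
      have hk2 := hsupp _ (right_ne_zero_of_mul hk)
      have hxa : κ (x a) = κ (y a) := by
        have := hk2.2 a
        rw [Function.update_of_ne hab, Function.update_self] at this
        rw [hk1, this]
      have hxb : κ (x b) = κ (y b) := by
        have := hk2.2 b
        rw [Function.update_self] at this
        rw [← hxab, hk1, this]
      have := (hupd x k hk1 hxa hxb hxab).1 hk2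
      exact ⟨(hcomp x).2 ⟨this.1, hxab⟩, this.2⟩
    · intro x z hx hz hxz
      obtain ⟨hx1, hx3⟩ := (hcomp x).1 hx.1
      obtain ⟨hz1, hz3⟩ := (hcomp z).1 hz.1
      rw [contract_apply κ hab, contract_apply κ hab, if_pos hx3, if_pos hz3]
      refine Finset.sum_congr rfl fun k _ => ?_
      have hκ : κ (x a) = κ (z a) := (hx.2 a).trans (hz.2 a).symm
      rw [avg_congr hκ rfl]
      by_cases hk : avg κ (z a) k = 0
      · rw [hk, zero_mul, zero_mul]
      have hk := class_eq_of_avg_ne hk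
      congr 1
      refine hdep _ _ ((hupd x k (hκ.trans hk) (hx.2 a) (hx.2 b) hx3).2 ⟨hx1, hx.2⟩)
        ((hupd z k hk (hz.2 a) (hz.2 b) hz3).2 ⟨hz1, hz.2⟩) fun c hc => ?_
      by_cases h1 : c = b
      · rw [h1, Function.update_self, Function.update_self]
      by_cases h2 : c = a
      · rw [h2, Function.update_of_ne hab, Function.update_of_ne hab, Function.update_self,
          Function.update_self]
      rw [Function.update_of_ne h1, Function.update_of_ne h2, Function.update_of_ne h1,
        Function.update_of_ne h2]
      exact hxz c (by simp [h1, h2, hc])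
    · rw [← Module.End.mul_apply, ← contract_mul_casimir κ ha hb hab, Module.End.mul_apply,
        casimir_eq_sub, LinearMap.sub_apply, h, sub_self, map_zero]

end Kernel

/-! ### Counting and conjugating perfect matchings -/

section Matching

variable {A I Q : Type*} [DecidableEq A] [DecidableEq I] [DecidableEq Q]

/-- `τ` is an involution that moves exactly the labels in `S`. -/
def IsMatchingOn (S : Finset A) (τ : Equiv.Perm A) : Prop :=
  (∀ c, τ (τ c) = c) ∧ ∀ c, τ c ≠ c ↔ c ∈ S

theorem IsMatchingOn.mul_swap_erase {S : Finset A} {τ : Equiv.Perm A} (h : IsMatchingOn S τ)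
    {a : A} :
    IsMatchingOn ((S.erase a).erase (τ a)) (τ * Equiv.swap a (τ a)) := by
  obtain ⟨h1, h2⟩ := h
  have ha : (τ * Equiv.swap a (τ a)) a = a := by simp [h1]
  have hb : (τ * Equiv.swap a (τ a)) (τ a) = τ a := by simp
  have hc : ∀ c, c ≠ a → c ≠ τ a → (τ * Equiv.swap a (τ a)) c = τ c := fun c hca hcb => by
    rw [Equiv.Perm.mul_apply, Equiv.swap_apply_of_ne_of_ne hca hcb]
  refine ⟨fun c => ?_, fun c => ?_⟩
  · by_cases hca : c = a
    · rw [hca, ha, ha]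
    by_cases hcb : c = τ a
    · rw [hcb, hb, hb]
    rw [hc c hca hcb, hc _ (fun h => hcb (by rw [← h, h1])) (fun h => hca (τ.injective h)), h1]
  · by_cases hca : c = a
    · rw [hca, ha]; simp
    by_cases hcb : c = τ a
    · rw [hcb, hb]; simp
    rw [hc c hca hcb, h2]
    simp [hca, hcb]

theorem IsMatchingOn.mul_swap {S : Finset A} {τ : Equiv.Perm A} {a b : A} (ha : a ∈ S)
    (hb : b ∈ S) (hab : a ≠ b) (h : IsMatchingOn ((S.erase a).erase b) τ) :
    IsMatchingOn S (τ * Equiv.swap a b) ∧ (τ * Equiv.swap a b) a = b := by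
  obtain ⟨h1, h2⟩ := h
  have hτa : τ a = a := by
    have := h2 a; simpa using this
  have hτb : τ b = b := by
    have := h2 b; simpa using this
  have ha' : (τ * Equiv.swap a b) a = b := by simp [hτb]
  have hb' : (τ * Equiv.swap a b) b = a := by simp [hτa]
  have hc : ∀ c, c ≠ a → c ≠ b → (τ * Equiv.swap a b) c = τ c := fun c hca hcb => by
    rw [Equiv.Perm.mul_apply, Equiv.swap_apply_of_ne_of_ne hca hcb]
  refine ⟨⟨fun c => ?_, fun c => ?_⟩, ha'⟩
  · by_cases hca : c = a
    · rw [hca, ha', hb']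
    by_cases hcb : c = b
    · rw [hcb, hb', ha']
    rw [hc c hca hcb, hc _ (fun h => hca (τ.injective (h.trans hτa.symm)))
      (fun h => hcb (τ.injective (h.trans hτb.symm))), h1]
  · by_cases hca : c = a
    · rw [hca, ha']; simp [ha, hab.symm]
    by_cases hcb : c = b
    · rw [hcb, hb']; simp [hb, hab]
    rw [hc c hca hcb, h2]
    simp [hca, hcb]

omit [DecidableEq I] in
theorem comp_mul_swap_eq_iff {x : A → I} {a b : A} (hab : x a = x b) (τ : Equiv.Perm A) :
    x ∘ (τ * Equiv.swap a b : Equiv.Perm A) = x ↔ x ∘ τ = x := by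
  have h : x ∘ Equiv.swap a b = x := by
    funext c
    rw [Function.comp_apply, Equiv.swap_apply_def]
    split_ifs with h1 h2
    · rw [h1, hab]
    · rw [h2, hab]
    · rfl
  constructor
  · intro h'
    funext c
    have := congrFun h' (Equiv.swap a b c)
    simp only [Function.comp_apply, Equiv.Perm.mul_apply, Equiv.swap_apply_self] at this
    rw [Function.comp_apply, this]
    exact congrFun h c
  · intro h'
    rw [Equiv.Perm.coe_mul, ← Function.comp_assoc, h', h]

-- Choose the partner of a label a among the n - 1 others at its site, then delete the pair: this is
-- the recursion k!! = (k - 1)(k - 2)!!.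
open Classical in
theorem card_matchingsOn [Fintype A] [Fintype I] (S : Finset A) (x : A → I) :
    (Finset.univ.filter fun τ : Equiv.Perm A => IsMatchingOn S τ ∧ x ∘ τ = x).card =
      ∏ i, dfact (S.filter fun a => x a = i).card := by
  induction hn : S.card using Nat.strong_induction_on generalizing S with
  | _ n ih =>
    subst hn
    rcases S.eq_empty_or_nonempty with rfl | ⟨a, ha⟩
    · have : (Finset.univ.filter fun τ : Equiv.Perm A => IsMatchingOn ∅ τ ∧ x ∘ τ = x) = {1} := by
        ext τ
        simp only [Finset.mem_filter, Finset.mem_univ, true_and, Finset.mem_singleton]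
        constructor
        · rintro ⟨⟨-, h⟩, -⟩
          ext c
          have := h c
          simpa using this
        · rintro rfl
          exact ⟨⟨fun c => rfl, fun c => by simp⟩, rfl⟩
      rw [this]
      simp [dfact]
    set T := (S.erase a).filter fun b => x b = x a with hT
    have hmaps : ∀ τ ∈ Finset.univ.filter fun τ : Equiv.Perm A => IsMatchingOn S τ ∧ x ∘ τ = x,
        τ a ∈ T := by
      intro τ hτ
      simp only [Finset.mem_filter, Finset.mem_univ, true_and] at hτ
      obtain ⟨⟨h1, h2⟩, h3⟩ := hτ
      rw [hT, Finset.mem_filter, Finset.mem_erase]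
      refine ⟨⟨(h2 a).2 ha, (h2 _).1 ?_⟩, congrFun h3 a⟩
      rw [h1]
      exact ((h2 a).2 ha).symm
    rw [Finset.card_eq_sum_card_fiberwise hmaps]
    have hfib : ∀ b ∈ T, ((Finset.univ.filter fun τ : Equiv.Perm A =>
        IsMatchingOn S τ ∧ x ∘ τ = x).filter fun τ => τ a = b).card =
        dfact ((S.filter fun c => x c = x a).card - 2) *
          ∏ i ∈ Finset.univ.erase (x a), dfact (S.filter fun c => x c = i).card := by
      intro b hb
      rw [hT, Finset.mem_filter, Finset.mem_erase] at hb
      obtain ⟨⟨hba, hbS⟩, hxb⟩ := hb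
      have hcard : ((Finset.univ.filter fun τ : Equiv.Perm A =>
          IsMatchingOn S τ ∧ x ∘ τ = x).filter fun τ => τ a = b).card =
          (Finset.univ.filter fun τ : Equiv.Perm A =>
            IsMatchingOn ((S.erase a).erase b) τ ∧ x ∘ τ = x).card := by
        refine Finset.card_nbij' (fun τ => τ * Equiv.swap a b) (fun τ => τ * Equiv.swap a b)
          ?_ ?_ ?_ ?_
        · intro τ hτ
          simp only [Finset.coe_filter, Finset.mem_filter, Finset.mem_univ, true_and,
            Set.mem_ofPred_eq] at hτ ⊢
          obtain ⟨⟨h1, h2⟩, rfl⟩ := hτ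
          exact ⟨h1.mul_swap_erase, (comp_mul_swap_eq_iff hxb.symm τ).2 h2⟩
        · intro τ hτ
          simp only [Finset.coe_filter, Finset.mem_filter, Finset.mem_univ, true_and,
            Set.mem_ofPred_eq] at hτ ⊢
          have := hτ.1.mul_swap ha hbS hba.symm
          exact ⟨⟨this.1, (comp_mul_swap_eq_iff hxb.symm τ).2 hτ.2⟩, this.2⟩
        · intro τ _; simp [mul_assoc]
        · intro τ _; simp [mul_assoc]
      rw [hcard, ih _ ?_ _ rfl]
      · have hbE : b ∈ S.erase a := Finset.mem_erase.2 ⟨hba, hbS⟩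
        have hsplit : ∀ i, (S.filter fun c => x c = i).card =
            (((S.erase a).erase b).filter fun c => x c = i).card + if x a = i then 2 else 0 := by
          intro i
          rw [Finset.card_filter, ← Finset.add_sum_erase S _ ha,
            ← Finset.add_sum_erase _ _ hbE, ← Finset.card_filter, hxb]
          split_ifs <;> omega
        rw [← Finset.mul_prod_erase _ _ (Finset.mem_univ (x a)), hsplit (x a), if_pos rfl,
          Nat.add_sub_cancel]
        congr 1
        refine Finset.prod_congr rfl fun i hi => ?_
        rw [hsplit i, if_neg (Finset.ne_of_mem_erase hi).symm, add_zero]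
      · exact (Finset.card_le_card (Finset.erase_subset _ _)).trans_lt
          (Finset.card_erase_lt_of_mem ha)
    rw [Finset.sum_congr rfl hfib, Finset.sum_const, smul_eq_mul,
      ← Finset.mul_prod_erase _ _ (Finset.mem_univ (x a)), ← mul_assoc]
    congr 1
    have hTc : (S.filter fun c => x c = x a).card = T.card + 1 := by
      rw [Finset.card_filter, ← Finset.add_sum_erase S _ ha, if_pos rfl, ← Finset.card_filter,
        add_comm]
    rw [hTc]
    -- If a is alone at its site there is no matching, in accordance with 1!! = 0.
    rcases T.card with _ | k
    · simp [dfact]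
    · simp [dfact]

-- Two matchings compatible with x are conjugate under the relabellings that fix x. The
-- transposition s of the two partners of a fixes x, since both partners sit at the site of a; after
-- conjugation by s both matchings contain the same pair at a, and induction treats the rest.
omit [DecidableEq I] in
theorem exists_conj_of_isMatchingOn (S : Finset A) (x : A → I) {τ τ' : Equiv.Perm A}
    (hτ : IsMatchingOn S τ) (hτ' : IsMatchingOn S τ') (hx : x ∘ τ = x) (hx' : x ∘ τ' = x) :
    ∃ σ : Equiv.Perm A, x ∘ σ = x ∧ (∀ c ∉ S, σ c = c) ∧ σ * τ = τ' * σ := by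
  induction hn : S.card using Nat.strong_induction_on generalizing S τ τ' with
  | _ n ih =>
    subst hn
    rcases S.eq_empty_or_nonempty with rfl | ⟨a, ha⟩
    · have : ∀ {ρ : Equiv.Perm A}, IsMatchingOn ∅ ρ → ρ = 1 := by
        intro ρ h
        ext c
        have := h.2 c
        simpa using this
      exact ⟨1, rfl, fun c _ => rfl, by rw [this hτ, this hτ']⟩
    have hb : τ a ∈ S := (hτ.2 _).1 (by rw [hτ.1]; exact ((hτ.2 a).2 ha).symm)
    have hb' : τ' a ∈ S := (hτ'.2 _).1 (by rw [hτ'.1]; exact ((hτ'.2 a).2 ha).symm)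
    have hne : τ a ≠ a := (hτ.2 a).2 ha
    have hne' : τ' a ≠ a := (hτ'.2 a).2 ha
    have hxb : x (τ a) = x (τ' a) := (congrFun hx a).trans (congrFun hx' a).symm
    set s := Equiv.swap (τ a) (τ' a) with hs
    have hss : ∀ c, s (s c) = c := Equiv.swap_apply_self _ _
    have hsS : ∀ c ∉ S, s c = c := fun c hc =>
      Equiv.swap_apply_of_ne_of_ne (fun h => hc (h ▸ hb)) (fun h => hc (h ▸ hb'))
    have hxs : x ∘ s = x := by
      have := (comp_mul_swap_eq_iff hxb 1).2 rfl
      rwa [one_mul] at this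
    have hsmem : ∀ c, s c ∈ S ↔ c ∈ S := by
      intro c
      by_cases hc : c ∈ S
      · refine iff_of_true (by_contra fun h => ?_) hc
        have := hsS _ h
        rw [hss] at this
        exact h (this ▸ hc)
      · rw [hsS c hc]
    have hτ1 : IsMatchingOn S (s * τ * s) := by
      refine ⟨fun c => ?_, fun c => ?_⟩
      · simp only [Equiv.Perm.mul_apply, hss, hτ.1]
      · rw [← hsmem c, ← hτ.2 (s c)]
        simp only [Equiv.Perm.mul_apply, ne_eq]
        rw [not_iff_not]
        constructor
        · intro h; have := congrArg s h; rwa [hss] at this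
        · intro h; rw [h, hss]
    have hτ1a : (s * τ * s) a = τ' a := by
      simp only [Equiv.Perm.mul_apply]
      rw [hs, Equiv.swap_apply_of_ne_of_ne hne.symm hne'.symm, Equiv.swap_apply_left]
    have hx1 : x ∘ (s * τ * s : Equiv.Perm A) = x := by
      rw [Equiv.Perm.coe_mul, Equiv.Perm.coe_mul, ← Function.comp_assoc, ← Function.comp_assoc,
        hxs, hx, hxs]
    have hxa : x a = x (τ' a) := (congrFun hx' a).symm
    have hE1 := hτ1.mul_swap_erase (a := a)
    rw [hτ1a] at hE1
    obtain ⟨σ, hσ1, hσ2, hσ3⟩ := ih _ ((Finset.card_le_card (Finset.erase_subset _ _)).trans_lt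
      (Finset.card_erase_lt_of_mem ha)) _ hE1 (hτ'.mul_swap_erase (a := a))
      ((comp_mul_swap_eq_iff hxa _).2 hx1) ((comp_mul_swap_eq_iff hxa _).2 hx') rfl
    -- The permutation σ fixes a and its partner, so the deleted pair can be restored on both sides.
    have hcomm : Equiv.swap a (τ' a) * σ = σ * Equiv.swap a (τ' a) := by
      have := Equiv.swap_apply_apply σ a (τ' a)
      rw [hσ2 a (by simp), hσ2 (τ' a) (by simp), eq_mul_inv_iff_mul_eq] at this
      exact this
    have hcancel : σ * (s * τ * s) = τ' * σ := by
      rw [mul_assoc τ', hcomm, ← mul_assoc, ← mul_assoc] at hσ3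
      exact mul_right_cancel hσ3
    refine ⟨σ * s, ?_, fun c hc => ?_, ?_⟩
    · rw [Equiv.Perm.coe_mul, ← Function.comp_assoc, hσ1, hxs]
    · rw [Equiv.Perm.mul_apply, hsS c hc, hσ2 c (by simp [hc])]
    · have hs2 : s * s = 1 := Equiv.swap_mul_self _ _
      rw [← mul_assoc τ', ← hcancel]
      simp only [mul_assoc, hs2, mul_one]

omit [DecidableEq A] in
theorem isMatchingOn_univ_iff [Fintype A] {τ : Equiv.Perm A} :
    IsMatchingOn Finset.univ τ ↔ IsMatching τ := by
  simp only [IsMatchingOn, IsMatching, Finset.mem_univ, iff_true]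
  refine and_congr_left fun _ => ⟨fun h => Equiv.ext h, fun h c => Equiv.congr_fun h c⟩

end Matching

/-! ### The local projection: fixed functions and boundedness -/

section Projection

variable {n N : ℕ} {Q : Type*} [DecidableEq Q]

/-- The number of perfect matchings of the labels that pair labels at the same site. -/
def matchCount (x : Fin n → Fin N) : ℝ := ∏ i, (dfact (particleNumber i x) : ℝ)

theorem weight_eq_matchCount_sq (x : Fin n → Fin N) : weight x = matchCount x ^ 2 := by
  rw [weight, matchCount, Finset.prod_pow]

open Classical in
theorem matchCount_eq_card (x : Fin n → Fin N) :
    matchCount x = ((Finset.univ.filter fun τ : Equiv.Perm (Fin n) =>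
      IsMatching τ ∧ x ∘ τ = x).card : ℝ) := by
  have h := card_matchingsOn Finset.univ x
  simp only [isMatchingOn_univ_iff] at h
  rw [h, Nat.cast_prod]
  rfl

theorem dfact_pos_of_even : ∀ {k : ℕ}, Even k → 0 < dfact k
  | 0, _ => Nat.one_pos
  | 1, h => absurd h (by decide)
  | k + 2, h => Nat.mul_pos (Nat.succ_pos _) (dfact_pos_of_even (by simpa [Nat.even_add] using h))

theorem matchCount_pos {x : Fin n → Fin N} (hx : x ∈ evenConfigs n N) : 0 < matchCount x := by
  simp only [evenConfigs, Finset.mem_filter, Finset.mem_univ, true_and] at hx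
  exact Finset.prod_pos fun i _ => Nat.cast_pos.2 (dfact_pos_of_even (hx i))

theorem particleNumber_comp (i : Fin N) (x : Fin n → Fin N) (σ : Equiv.Perm (Fin n)) :
    particleNumber i (x ∘ σ) = particleNumber i x :=
  Finset.card_bij (fun c _ => σ c) (fun c hc => by simpa using hc)
    (fun c _ d _ h => σ.injective h)
    (fun c hc => ⟨σ.symm c, by simpa using hc, by simp⟩)

theorem matchCount_comp (x : Fin n → Fin N) (σ : Equiv.Perm (Fin n)) :
    matchCount (x ∘ σ) = matchCount x := by
  simp only [matchCount, particleNumber_comp]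

theorem comp_eq_of_partition_le {x z : Fin n → Fin N}
    (h : positionPartition z ≤ positionPartition x) {τ : Fin n → Fin n} (hz : z ∘ τ = z) :
    x ∘ τ = x :=
  funext fun a => h (congrFun hz a)

open Classical in
/-- The invariant tensors, divided by `matchCount`, are fixed by the local projection; here the
denominators are cleared. -/
theorem pairTensor_mul_sum_weight (κ : Fin N → Q) (y : Fin n → Fin N)
    {V : Finset (Fin n → Fin N)}
    (hV : ∀ x, x ∈ V ↔ x ∈ evenConfigs n N ∧ ∀ a, κ (x a) = κ (y a))
    {τ : Equiv.Perm (Fin n)} (hτ : IsMatching τ) {x : Fin n → Fin N} (hx : x ∈ V) :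
    pairTensor κ y τ x *
        ∑ z ∈ V.filter (fun z => positionPartition z ≤ positionPartition x), weight z =
      matchCount x * ∑ z ∈ V.filter (fun z => positionPartition z ≤ positionPartition x),
        matchCount z * pairTensor κ y τ z := by
  set Z := V.filter (fun z => positionPartition z ≤ positionPartition x) with hZ
  have hpt : ∀ z ∈ V, ∀ ρ : Equiv.Perm (Fin n),
      pairTensor κ y ρ z = if z ∘ ρ = z then 1 else 0 := by
    intro z hz ρ
    simp [pairTensor, ((hV z).1 hz).2]
  have hZV : ∀ z ∈ Z, z ∈ V := fun z hz => (Finset.mem_filter.1 hz).1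
  have hZP : ∀ z ∈ Z, positionPartition z ≤ positionPartition x := fun z hz =>
    (Finset.mem_filter.1 hz).2
  by_cases hxτ : x ∘ τ = x
  swap
  · rw [hpt x hx, if_neg hxτ, zero_mul, Finset.sum_eq_zero, mul_zero]
    intro z hz
    rw [hpt z (hZV z hz), if_neg fun h => hxτ (comp_eq_of_partition_le (hZP z hz) h), mul_zero]
  -- All matchings compatible with x give the same sum: a conjugating relabelling fixes x, hence
  -- permutes the configurations refining x and preserves M.
  have hconj : ∀ ρ : Equiv.Perm (Fin n), IsMatching ρ → x ∘ ρ = x →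
      ∑ z ∈ Z, matchCount z * pairTensor κ y ρ z =
        ∑ z ∈ Z, matchCount z * pairTensor κ y τ z := by
    intro ρ hρ hxρ
    obtain ⟨σ, hσ1, -, hσ3⟩ := exists_conj_of_isMatchingOn Finset.univ x
      (isMatchingOn_univ_iff.2 hτ) (isMatchingOn_univ_iff.2 hρ) hxτ hxρ
    have hmem : ∀ (ς : Equiv.Perm (Fin n)), x ∘ ς = x → ∀ z ∈ Z, z ∘ ς ∈ Z := by
      intro ς hς z hz
      have h1 := (hV z).1 (hZV z hz)
      have h2 := ((hV x).1 hx).2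
      rw [hZ, Finset.mem_filter, hV]
      refine ⟨⟨?_, fun a => ?_⟩, fun a b hab => ?_⟩
      · have h3 := h1.1
        simp only [evenConfigs, Finset.mem_filter, Finset.mem_univ, true_and,
          particleNumber_comp] at h3 ⊢
        exact h3
      · rw [Function.comp_apply, h1.2, ← h2, ← h2 a]
        exact congrArg κ (congrFun hς a)
      · have h4 : x (ς a) = x (ς b) := hZP z hz hab
        have e1 : x (ς a) = x a := congrFun hς a
        have e2 : x (ς b) = x b := congrFun hς b
        exact e1.symm.trans (h4.trans e2)
    have hσi : x ∘ σ.symm = x := by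
      funext c
      have := congrFun hσ1 (σ.symm c)
      simpa using this.symm
    refine Finset.sum_nbij' (fun z => z ∘ σ) (fun z => z ∘ σ.symm) (hmem σ hσ1)
      (hmem σ.symm hσi) (fun z _ => by funext c; simp) (fun z _ => by funext c; simp) ?_
    intro z hz
    rw [matchCount_comp, hpt z (hZV z hz), hpt _ (hZV _ (hmem σ hσ1 z hz))]
    congr 2
    refine propext ⟨fun h => ?_, fun h => ?_⟩
    · rw [Function.comp_assoc, ← Equiv.Perm.coe_mul, hσ3, Equiv.Perm.coe_mul,
        ← Function.comp_assoc, h]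
    · rw [Function.comp_assoc, ← Equiv.Perm.coe_mul, hσ3, Equiv.Perm.coe_mul,
        ← Function.comp_assoc] at h
      funext c
      have := congrFun h (σ.symm c)
      simpa using this
  -- Replace the factor M(x) by a sum over the matchings compatible with x. Every matching
  -- compatible with a refining z is among them, so each z receives M(z)·M(z) = π(z).
  rw [hpt x hx, if_pos hxτ, one_mul, matchCount_eq_card, ← nsmul_eq_mul, ← Finset.sum_const]
  rw [Finset.sum_congr rfl fun ρ hρ => (hconj ρ (Finset.mem_filter.1 hρ).2.1
    (Finset.mem_filter.1 hρ).2.2).symm, Finset.sum_comm]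
  refine Finset.sum_congr rfl fun z hz => ?_
  rw [← Finset.mul_sum, weight_eq_matchCount_sq, sq]
  congr 1
  rw [Finset.sum_congr rfl fun ρ _ => hpt z (hZV z hz) ρ, ← Finset.sum_filter, Finset.sum_const,
    nsmul_eq_mul, mul_one, matchCount_eq_card, Finset.filter_filter]
  congr 2
  ext ρ
  simp only [Finset.mem_filter, Finset.mem_univ, true_and]
  exact ⟨fun h => ⟨⟨h.1, comp_eq_of_partition_le (hZP z hz) h.2⟩, h.2⟩, fun h => ⟨h.1.1, h.2⟩⟩

open Classical in
theorem mul_sum_weight_of_mem_pairSpan (κ : Fin N → Q) (y : Fin n → Fin N)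
    {V : Finset (Fin n → Fin N)}
    (hV : ∀ x, x ∈ V ↔ x ∈ evenConfigs n N ∧ ∀ a, κ (x a) = κ (y a))
    {S : Finset (Fin n)} {ρ : Equiv.Perm (Fin n)}
    {F : (Fin n → Fin N) → ℝ} (hF : F ∈ pairSpan κ y S ρ) {x : Fin n → Fin N} (hx : x ∈ V) :
    F x * ∑ z ∈ V.filter (fun z => positionPartition z ≤ positionPartition x), weight z =
      matchCount x * ∑ z ∈ V.filter (fun z => positionPartition z ≤ positionPartition x),
        matchCount z * F z := by
  induction hF using Submodule.span_induction with
  | mem F hF =>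
    obtain ⟨τ, hτ, -, rfl⟩ := hF
    exact pairTensor_mul_sum_weight κ y hV hτ hx
  | zero => simp
  | add F G _ _ hF hG =>
    simp only [Pi.add_apply, add_mul, mul_add, Finset.sum_add_distrib, hF, hG]
  | smul r F _ hF =>
    rw [Pi.smul_apply, smul_eq_mul, mul_assoc, hF, Finset.mul_sum, Finset.mul_sum, Finset.mul_sum]
    exact Finset.sum_congr rfl fun z _ => by simp only [Pi.smul_apply, smul_eq_mul]; ring

theorem weight_nonneg (x : Fin n → Fin N) : 0 ≤ weight x :=
  Finset.prod_nonneg fun _ _ => sq_nonneg _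

noncomputable instance : Fintype (Setoid (Fin n)) :=
  @Fintype.ofFinite _ (Finite.of_injective (fun s : Setoid (Fin n) => s.r)
    fun _ _ h => Setoid.ext fun a b => iff_of_eq (congrFun (congrFun h a) b))

/-- The local projection is bounded on `ℓ²(π)`. -/
theorem sum_weight_mul_localProj_sq_le (y : Fin n → Fin N) (ℓ : ℝ) (f : (Fin n → Fin N) → ℝ) :
    ∑ x ∈ localNbhd y ℓ, weight x * localProj y ℓ f x ^ 2 ≤
      Fintype.card (Setoid (Fin n)) * ∑ x ∈ localNbhd y ℓ, weight x * f x ^ 2 := by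
  classical
  set V := localNbhd y ℓ
  let Z : Setoid (Fin n) → ℝ := fun p => ∑ z ∈ V.filter (fun z => positionPartition z ≤ p), weight z
  let G : Setoid (Fin n) → ℝ := fun p =>
    ∑ z ∈ V.filter (fun z => positionPartition z ≤ p), weight z * f z ^ 2
  have hG0 : ∀ p, 0 ≤ G p := fun p =>
    Finset.sum_nonneg fun z _ => mul_nonneg (weight_nonneg z) (sq_nonneg _)
  have hZ0 : ∀ p, 0 ≤ Z p := fun p => Finset.sum_nonneg fun z _ => weight_nonneg z
  have h1 : ∀ x, localProj y ℓ f x ^ 2 ≤ G (positionPartition x) / Z (positionPartition x) := by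
    intro x
    have hCS := Finset.sum_sq_le_sum_mul_sum_of_sq_le_mul
      (V.filter (fun z => positionPartition z ≤ positionPartition x))
      (r := fun z => weight z * f z) (f := weight) (g := fun z => weight z * f z ^ 2)
      (fun z _ => weight_nonneg z) (fun z _ => mul_nonneg (weight_nonneg z) (sq_nonneg _))
      (fun z _ => le_of_eq (by ring))
    have e : localProj y ℓ f x = (∑ z ∈ V.filter (fun z => positionPartition z ≤
      positionPartition x), weight z * f z) / Z (positionPartition x) := by
      simp only [localProj, Z, V]
    rw [e, div_pow]
    -- If the total mass is 0, both quotients are 0 by the convention for division by zero.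
    rcases (hZ0 (positionPartition x)).eq_or_lt with h0 | h0
    · rw [← h0]; simp
    · rw [div_le_div_iff₀ (by positivity) h0]
      calc _ ≤ (Z (positionPartition x) * G (positionPartition x)) * Z (positionPartition x) :=
            mul_le_mul_of_nonneg_right hCS h0.le
        _ = _ := by ring
  calc ∑ x ∈ V, weight x * localProj y ℓ f x ^ 2
      ≤ ∑ x ∈ V, weight x * (G (positionPartition x) / Z (positionPartition x)) :=
        Finset.sum_le_sum fun x _ => mul_le_mul_of_nonneg_left (h1 x) (weight_nonneg x)
    _ = ∑ p, ∑ x ∈ V.filter (fun x => positionPartition x = p),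
          weight x * (G (positionPartition x) / Z (positionPartition x)) :=
        (Finset.sum_fiberwise V positionPartition _).symm
    _ ≤ ∑ p : Setoid (Fin n), ∑ x ∈ V, weight x * f x ^ 2 := by
        -- The configurations with partition exactly p have mass at most `Z p`, so they contribute
        -- at most `G p`, which is at most the full norm. The constant is therefore the number of
        -- partitions.
        refine Finset.sum_le_sum fun p _ => ?_
        have e : ∑ x ∈ V.filter (fun x => positionPartition x = p),
            weight x * (G (positionPartition x) / Z (positionPartition x)) =
            (∑ x ∈ V.filter (fun x => positionPartition x = p), weight x) * (G p / Z p) := by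
          rw [Finset.sum_mul]
          exact Finset.sum_congr rfl fun x hx => by rw [(Finset.mem_filter.1 hx).2]
        have h2 : ∑ x ∈ V.filter (fun x => positionPartition x = p), weight x ≤ Z p :=
          Finset.sum_le_sum_of_subset_of_nonneg
            (fun x hx => by
              rw [Finset.mem_filter] at hx ⊢
              exact ⟨hx.1, hx.2.le⟩) fun x _ _ => weight_nonneg x
        have h3 : Z p * (G p / Z p) ≤ G p := by
          rcases (hZ0 p).eq_or_lt with h0 | h0
          · rw [← h0, zero_mul]; exact hG0 p
          · rw [mul_div_cancel₀ _ h0.ne']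
        rw [e]
        refine (mul_le_mul_of_nonneg_right h2 (div_nonneg (hG0 p) (hZ0 p))).trans (h3.trans ?_)
        exact Finset.sum_le_sum_of_subset_of_nonneg (Finset.filter_subset _ _)
          fun x _ _ => mul_nonneg (weight_nonneg x) (sq_nonneg _)
    _ = _ := by rw [Finset.sum_const, nsmul_eq_mul, Finset.card_univ]

end Projection

/-! ### The generator as the square of an infinitesimal rotation -/

section Generator

variable {n N : ℕ}

theorem univ_filter_ne {A : Type*} [Fintype A] [DecidableEq A] (a : A) :
    (Finset.univ.filter fun b => a ≠ b) = Finset.univ.erase a := by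
  ext b; simp [eq_comm]

theorem shift_mul_shift_apply {i j : Fin N} (hij : i ≠ j) (F : (Fin n → Fin N) → ℝ)
    (x : Fin n → Fin N) :
    shift Finset.univ i j (shift Finset.univ i j F) x =
      ∑ a, ∑ b ∈ Finset.univ.filter (fun b => a ≠ b),
        if x a = i ∧ x b = i then F (jump a b i j x) else 0 := by
  simp only [shift, LinearMap.sum_apply, Finset.sum_apply, map_sum]
  rw [Finset.sum_comm]
  refine Finset.sum_congr rfl fun a _ => ?_
  rw [univ_filter_ne, ← Finset.add_sum_erase _ _ (Finset.mem_univ a)]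
  have h0 : hop a i j (hop a i j F) x = 0 := by
    rw [← Module.End.mul_apply, hop_mul_self, if_neg hij.symm]; rfl
  rw [h0, zero_add]
  refine Finset.sum_congr rfl fun b hb => ?_
  have hba := Finset.ne_of_mem_erase hb
  simp only [hop_apply, Function.update_of_ne hba, ← ite_and]
  split_ifs with h
  · congr 1
    funext c
    simp only [jump, h, and_self, and_true, Function.update_apply]
    by_cases h1 : c = a <;> by_cases h2 : c = b <;> simp [h1, h2]
  · rfl

theorem shift_mul_shift_symm_apply {i j : Fin N} (F : (Fin n → Fin N) → ℝ)
    (x : Fin n → Fin N) :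
    shift Finset.univ i j (shift Finset.univ j i F) x =
      (particleNumber i x : ℝ) * F x + ∑ a, ∑ b ∈ Finset.univ.filter (fun b => a ≠ b),
        if x a = i ∧ x b = j then F (swap a b i j x) else 0 := by
  have h0 : (particleNumber i x : ℝ) * F x = ∑ a, if x a = i then F x else 0 := by
    rw [← Finset.sum_filter, Finset.sum_const, nsmul_eq_mul]; rfl
  rw [h0, ← Finset.sum_add_distrib]
  simp only [shift, LinearMap.sum_apply, Finset.sum_apply, map_sum]
  rw [Finset.sum_comm]
  refine Finset.sum_congr rfl fun a _ => ?_
  rw [univ_filter_ne, ← Finset.add_sum_erase _ _ (Finset.mem_univ a)]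
  congr 1
  · rw [← Module.End.mul_apply, hop_mul_self, if_pos rfl, hop_apply]
    split_ifs with h
    · rw [← h, Function.update_eq_self]
    · rfl
  refine Finset.sum_congr rfl fun b hb => ?_
  have hba := Finset.ne_of_mem_erase hb
  simp only [hop_apply, Function.update_of_ne hba, ← ite_and]
  split_ifs with h
  · congr 1
    funext c
    simp only [swap, h, and_self, if_true, Function.update_apply]
    by_cases h1 : c = a <;> by_cases h2 : c = b <;> simp_all
  · rfl

theorem swap_comm (a b : Fin n) (i j : Fin N) (hij : i ≠ j) (x : Fin n → Fin N) :
    swap a b i j x = swap b a j i x := by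
  funext c
  simp only [swap]
  by_cases h : x a = i ∧ x b = j
  · have hab : a ≠ b := by rintro rfl; exact hij (h.1.symm.trans h.2)
    rw [if_pos h, if_pos h.symm]
    by_cases h1 : c = a
    · simp [h1, hab]
    · simp [h1]
  · rw [if_neg h, if_neg fun h' => h h'.symm]

theorem sum_swap_comm {i j : Fin N} (hij : i ≠ j) (F : (Fin n → Fin N) → ℝ)
    (x : Fin n → Fin N) :
    (∑ a, ∑ b ∈ Finset.univ.filter (fun b => a ≠ b),
        if x a = i ∧ x b = j then F (swap a b i j x) else 0) =
      ∑ a, ∑ b ∈ Finset.univ.filter (fun b => a ≠ b),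
        if x a = j ∧ x b = i then F (swap a b j i x) else 0 := by
  simp only [Finset.sum_filter]
  rw [Finset.sum_comm]
  refine Finset.sum_congr rfl fun a _ => Finset.sum_congr rfl fun b _ => ?_
  rw [swap_comm b a i j hij]
  simp only [ne_comm (a := b), and_comm (a := x b = i)]

theorem sum_pairs_same (i : Fin N) (x : Fin n → Fin N) :
    (∑ a, ∑ b ∈ Finset.univ.filter (fun b => a ≠ b),
        if x a = i ∧ x b = i then (1 : ℝ) else 0) =
      particleNumber i x * ((particleNumber i x : ℝ) - 1) := by
  have h : ∀ a, (∑ b ∈ Finset.univ.filter (fun b => a ≠ b),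
      if x a = i ∧ x b = i then (1 : ℝ) else 0) =
      if x a = i then ((particleNumber i x : ℝ) - 1) else 0 := by
    intro a
    by_cases ha : x a = i
    · have : (particleNumber i x : ℝ) = ∑ b, if x b = i then (1 : ℝ) else 0 := by
        rw [← Finset.sum_filter, Finset.sum_const, nsmul_eq_mul, mul_one]; rfl
      rw [univ_filter_ne, if_pos ha, this, ← Finset.add_sum_erase _ _ (Finset.mem_univ a)]
      simp [ha]
    · simp [ha]
  rw [Finset.sum_congr rfl fun a _ => h a, ← Finset.sum_filter, Finset.sum_const, nsmul_eq_mul]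
  rfl

theorem sum_pairs_ne {i j : Fin N} (hij : i ≠ j) (x : Fin n → Fin N) :
    (∑ a, ∑ b ∈ Finset.univ.filter (fun b => a ≠ b),
        if x a = i ∧ x b = j then (1 : ℝ) else 0) =
      particleNumber i x * particleNumber j x := by
  have h : ∀ a, (∑ b ∈ Finset.univ.filter (fun b => a ≠ b),
      if x a = i ∧ x b = j then (1 : ℝ) else 0) =
      if x a = i then (particleNumber j x : ℝ) else 0 := by
    intro a
    by_cases ha : x a = i
    · have : (particleNumber j x : ℝ) = ∑ b, if x b = j then (1 : ℝ) else 0 := by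
        rw [← Finset.sum_filter, Finset.sum_const, nsmul_eq_mul, mul_one]; rfl
      rw [univ_filter_ne, if_pos ha, this, ← Finset.add_sum_erase _ _ (Finset.mem_univ a)]
      simp [ha, hij]
    · simp [ha]
  rw [Finset.sum_congr rfl fun a _ => h a, ← Finset.sum_filter, Finset.sum_const, nsmul_eq_mul]
  rfl

/-- With a and b removed, inserting a pair at a site with m labels multiplies M by m + 1. So the
move rate (n_j+1)/(n_i-1) is exactly the ratio of M after and before the jump, which is why
conjugation by M removes it. -/
theorem matchCount_jump {a b : Fin n} (hab : a ≠ b) {i j : Fin N} (hij : i ≠ j)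
    {x : Fin n → Fin N} (ha : x a = i) (hb : x b = i) :
    matchCount (jump a b i j x) * ((particleNumber i x : ℝ) - 1) =
      matchCount x * ((particleNumber j x : ℝ) + 1) := by
  set m : Fin N → ℕ := fun k =>
    (((Finset.univ.erase a).erase b).filter fun c => x c = k).card with hm
  have hx : x = Function.update (Function.update x a i) b i := by
    rw [← ha, Function.update_eq_self, ha, ← hb, Function.update_eq_self]
  have hj : jump a b i j x = Function.update (Function.update x a j) b j := by
    funext c
    simp only [jump, ha, hb, and_self, and_true, Function.update_apply]
    by_cases h1 : c = a <;> by_cases h2 : c = b <;> simp [h1, h2]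
  have hp : ∀ l k, particleNumber k (Function.update (Function.update x a l) b l) =
      m k + if l = k then 2 else 0 := fun l k =>
    card_filter_update_pair (Finset.mem_univ a) (Finset.mem_univ b) hab x k l
  have hM : ∀ l, matchCount (Function.update (Function.update x a l) b l) =
      ((m l : ℝ) + 1) * ∏ k, (dfact (m k) : ℝ) := by
    intro l
    have h1 : ∀ k, (dfact (particleNumber k (Function.update (Function.update x a l) b l)) : ℝ) =
        (if l = k then (m k : ℝ) + 1 else 1) * dfact (m k) := by
      intro k
      rw [hp]
      split_ifs
      · rw [dfact]; push_cast; ring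
      · simp
    rw [matchCount, Finset.prod_congr rfl fun k _ => h1 k, Finset.prod_mul_distrib]
    simp
  have e1 : matchCount x = ((m i : ℝ) + 1) * ∏ k, (dfact (m k) : ℝ) := by
    rw [← hM i, ← hx]
  have e2 : (particleNumber i x : ℝ) = m i + 2 := by
    have := hp i i
    rw [← hx, if_pos rfl] at this
    rw [this]; push_cast; ring
  have e3 : (particleNumber j x : ℝ) = m j := by
    have := hp i j
    rw [← hx, if_neg hij] at this
    rw [this, add_zero]
  rw [hj, hM, e1, e2, e3]
  ring

open Classical in
/-- The tensor attached to a function on the local neighborhood. -/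
noncomputable def localTensor (y : Fin n → Fin N) (ℓ : ℝ) (f : (Fin n → Fin N) → ℝ)
    (x : Fin n → Fin N) : ℝ :=
  if x ∈ localNbhd y ℓ then matchCount x * f x else 0

theorem localTensor_apply {y : Fin n → Fin N} {ℓ : ℝ} (f : (Fin n → Fin N) → ℝ)
    {x : Fin n → Fin N} (hx : x ∈ localNbhd y ℓ) :
    localTensor y ℓ f x = matchCount x * f x := if_pos hx

theorem matchCount_mul_move {y : Fin n → Fin N} {ℓ : ℝ} {i j : Fin N} (hij : i ≠ j)
    (hr : localRel y ℓ i j) (f : (Fin n → Fin N) → ℝ) {x : Fin n → Fin N}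
    (hx : x ∈ localNbhd y ℓ) :
    matchCount x * (((particleNumber j x : ℝ) + 1) / ((particleNumber i x : ℝ) - 1) *
      ∑ a : Fin n, ∑ b ∈ Finset.univ.filter (fun b => a ≠ b), (f (jump a b i j x) - f x)) =
    shift Finset.univ i j (shift Finset.univ i j (localTensor y ℓ f)) x -
      particleNumber i x * ((particleNumber j x : ℝ) + 1) * localTensor y ℓ f x := by
  have hev : Even (particleNumber i x) := by
    have := hx
    simp only [localNbhd, Finset.mem_filter] at this
    have := this.1
    simp only [evenConfigs, Finset.mem_filter, Finset.mem_univ, true_and] at this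
    exact this i
  have hne : (particleNumber i x : ℝ) - 1 ≠ 0 := by
    intro h
    have h1 : particleNumber i x = 1 := by
      have : (particleNumber i x : ℝ) = 1 := by linarith
      exact_mod_cast this
    rw [h1] at hev
    exact absurd hev (by decide)
  have hterm : ∀ a, ∀ b ∈ Finset.univ.filter (fun b => a ≠ b),
      matchCount x * (((particleNumber j x : ℝ) + 1) / ((particleNumber i x : ℝ) - 1) *
        (f (jump a b i j x) - f x)) =
      (if x a = i ∧ x b = i then localTensor y ℓ f (jump a b i j x) else 0) -
        ((particleNumber j x : ℝ) + 1) / ((particleNumber i x : ℝ) - 1) *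
          localTensor y ℓ f x * if x a = i ∧ x b = i then 1 else 0 := by
    intro a b hb
    have hab : a ≠ b := (Finset.mem_filter.1 hb).2
    split_ifs with h
    · rw [localTensor_apply f hx, localTensor_apply f (jump_mem_localNbhd hab hr hx)]
      have := matchCount_jump hab hij h.1 h.2
      field_simp
      linear_combination (-f (jump a b i j x)) * this
    · have : jump a b i j x = x := by funext c; simp [jump, h]
      rw [this]; ring
  rw [shift_mul_shift_apply hij, Finset.mul_sum, Finset.mul_sum]
  simp only [Finset.mul_sum]
  rw [Finset.sum_congr rfl fun a _ => Finset.sum_congr rfl fun b hb => hterm a b hb]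
  simp only [Finset.sum_sub_distrib, ← Finset.mul_sum, sum_pairs_same]
  congr 1
  field_simp

theorem matchCount_mul_exchOp {y : Fin n → Fin N} {ℓ : ℝ} {i j : Fin N} (hij : i ≠ j)
    (hr : localRel y ℓ i j) (f : (Fin n → Fin N) → ℝ) {x : Fin n → Fin N}
    (hx : x ∈ localNbhd y ℓ) :
    matchCount x * exchOp i j f x =
      shift Finset.univ i j (shift Finset.univ j i (localTensor y ℓ f)) x +
      shift Finset.univ j i (shift Finset.univ i j (localTensor y ℓ f)) x -
      (particleNumber i x + particleNumber j x + 2 * particleNumber i x * particleNumber j x) *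
        localTensor y ℓ f x := by
  have hterm : ∀ a, ∀ b ∈ Finset.univ.filter (fun b => a ≠ b),
      matchCount x * (f (swap a b i j x) - f x) =
      (if x a = i ∧ x b = j then localTensor y ℓ f (swap a b i j x) else 0) -
          localTensor y ℓ f x * if x a = i ∧ x b = j then 1 else 0 := by
    intro a b _
    split_ifs with h
    · have hM : matchCount (swap a b i j x) = matchCount x := by
        rw [swap_eq_comp h, matchCount_comp]
      rw [localTensor_apply f hx, localTensor_apply f (swap_mem_localNbhd hr hx), hM]
      ring
    · have : swap a b i j x = x := by funext c; simp [swap, h]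
      rw [this]; ring
  have hsum : matchCount x * ∑ a : Fin n, ∑ b ∈ Finset.univ.filter (fun b => a ≠ b),
      (f (swap a b i j x) - f x) =
      (∑ a, ∑ b ∈ Finset.univ.filter (fun b => a ≠ b),
        if x a = i ∧ x b = j then localTensor y ℓ f (swap a b i j x) else 0) -
      localTensor y ℓ f x * (particleNumber i x * particleNumber j x) := by
    simp only [Finset.mul_sum]
    rw [Finset.sum_congr rfl fun a _ => Finset.sum_congr rfl fun b hb => hterm a b hb]
    simp only [Finset.sum_sub_distrib, ← Finset.mul_sum, sum_pairs_ne hij]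
  rw [exchOp, shift_mul_shift_symm_apply, shift_mul_shift_symm_apply,
    ← sum_swap_comm hij, ← mul_assoc, mul_comm _ (2 : ℝ), mul_assoc, hsum]
  ring

/-- The two squares of the expansion give the moves and the two mixed products give the exchange.
The diagonal terms cancel: nᵢ(n_j+1) + n_j(nᵢ+1) = nᵢ + n_j + 2nᵢn_j. -/
theorem rot_rot_localTensor {y : Fin n → Fin N} {ℓ : ℝ} {i j : Fin N} (hij : i ≠ j)
    (hr : localRel y ℓ i j) (f : (Fin n → Fin N) → ℝ) {x : Fin n → Fin N}
    (hx : x ∈ localNbhd y ℓ) :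
    rot Finset.univ i j (rot Finset.univ i j (localTensor y ℓ f)) x =
      matchCount x * gen i j f x := by
  rw [gen, moveOp, mul_sub, mul_add, matchCount_mul_move hij hr f hx,
    matchCount_mul_move hij.symm (hr.symm _ _) f hx, matchCount_mul_exchOp hij hr f hx]
  simp only [rot, LinearMap.sub_apply, map_sub, Pi.sub_apply]
  ring

theorem localInner_neg_gen {y : Fin n → Fin N} {ℓ : ℝ} {i j : Fin N} (hij : i ≠ j)
    (hr : localRel y ℓ i j) (f : (Fin n → Fin N) → ℝ) :
    localInner y ℓ f (fun x => -gen i j f x) =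
      ∑ x, (rot Finset.univ i j (localTensor y ℓ f) x) ^ 2 := by
  have h : ∑ x, (rot Finset.univ i j (localTensor y ℓ f) x) ^ 2 =
      -∑ x, localTensor y ℓ f x * rot Finset.univ i j (rot Finset.univ i j (localTensor y ℓ f)) x
      := by
    rw [← sum_rot_mul]
    exact Finset.sum_congr rfl fun x _ => sq _
  rw [h, localInner, ← Finset.sum_neg_distrib]
  rw [← Finset.sum_subset (Finset.subset_univ (localNbhd y ℓ))]
  · refine Finset.sum_congr rfl fun x hx => ?_
    rw [rot_rot_localTensor hij hr f hx, localTensor_apply f hx, weight_eq_matchCount_sq]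
    ring
  · intro x _ hx
    simp [localTensor, hx]

end Generator

/-! ### Geometry of the classes and comparison with the mean-field form -/

section Classes

variable {n N : ℕ}

/-- The class of a site under the local equivalence relation. -/
def siteClass (y : Fin n → Fin N) (ℓ : ℝ) (i : Fin N) :
    Quotient (Relation.EqvGen.setoid (nearRel y ℓ)) := Quotient.mk _ i

theorem siteClass_eq_iff {y : Fin n → Fin N} {ℓ : ℝ} {i j : Fin N} :
    siteClass y ℓ i = siteClass y ℓ j ↔ localRel y ℓ i j := Quotient.eq

/-- In a generating pair of distinct sites one site differs from the centre y_a, so integrality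
forces ℓ ≥ 1. This absorbs the +1 when counting the sites of a nontrivial class, giving a bound
linear in ℓ. -/
theorem near_of_localRel {y : Fin n → Fin N} {ℓ : ℝ} {i j : Fin N} (h : localRel y ℓ i j) :
    i = j ∨ ((∃ a, |(i : ℝ) - (y a : ℝ)| ≤ ℓ) ∧ (∃ a, |(j : ℝ) - (y a : ℝ)| ≤ ℓ) ∧ 1 ≤ ℓ) := by
  induction h with
  | rel i j h =>
    obtain ⟨a, hi, hj⟩ := h
    by_cases hij : i = j
    · exact Or.inl hij
    refine Or.inr ⟨⟨a, hi⟩, ⟨a, hj⟩, ?_⟩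
    have key : ∀ k : Fin N, k ≠ y a → 1 ≤ |(k : ℝ) - (y a : ℝ)| := by
      intro k hk
      have h1 : ((k : ℕ) : ℤ) - ((y a : ℕ) : ℤ) ≠ 0 := by
        intro h; exact hk (Fin.ext (by omega))
      have h2 := Int.one_le_abs h1
      exact_mod_cast h2
    by_cases hia : i = y a
    · exact (key j fun h => hij (hia.trans h.symm)).trans hj
    · exact (key i hia).trans hi
  | refl i => exact Or.inl rfl
  | symm i j _ ih =>
    rcases ih with rfl | ⟨h1, h2, h3⟩
    · exact Or.inl rfl
    · exact Or.inr ⟨h2, h1, h3⟩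
  | trans i j k _ _ ih1 ih2 =>
    rcases ih1 with rfl | ⟨h1, h2, h3⟩
    · exact ih2
    rcases ih2 with rfl | ⟨h4, h5, h6⟩
    · exact Or.inr ⟨h1, h2, h3⟩
    · exact Or.inr ⟨h1, h5, h6⟩

/-- Classes are intervals, since balls are; this is what bounds |i - j| by the class size. -/
theorem localRel_of_between {y : Fin n → Fin N} {ℓ : ℝ} {i j : Fin N} (h : localRel y ℓ i j) :
    ∀ k, (i ≤ k ∧ k ≤ j) ∨ (j ≤ k ∧ k ≤ i) → localRel y ℓ i k := by
  induction h with
  | rel i j h =>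
    obtain ⟨a, hi, hj⟩ := h
    intro k hk
    refine Relation.EqvGen.rel _ _ ⟨a, hi, ?_⟩
    rw [abs_le] at hi hj ⊢
    rcases hk with ⟨h1, h2⟩ | ⟨h1, h2⟩ <;>
    · have h1' : ((_ : Fin N) : ℝ) ≤ _ := Nat.cast_le (α := ℝ).2 (Fin.le_def.1 h1)
      have h2' : ((_ : Fin N) : ℝ) ≤ _ := Nat.cast_le (α := ℝ).2 (Fin.le_def.1 h2)
      constructor <;> linarith
  | refl i =>
    intro k hk
    have : k = i := by rcases hk with h | h <;> exact le_antisymm (by tauto) (by tauto)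
    rw [this]
    exact Relation.EqvGen.refl i
  | symm i j hij ih =>
    intro k hk
    exact (Relation.EqvGen.symm _ _ hij).trans _ _ _ (ih k hk.symm)
  | trans i j k hij hjk ih1 ih2 =>
    intro l hl
    rcases le_total l j with h | h
    · rcases hl with hl | hl
      · exact ih1 l (Or.inl ⟨hl.1, h⟩)
      · exact hij.trans _ _ _ (ih2 l (Or.inr ⟨hl.1, h⟩))
    · rcases hl with hl | hl
      · exact hij.trans _ _ _ (ih2 l (Or.inl ⟨h, hl.2⟩))
      · exact ih1 l (Or.inr ⟨h, hl.2⟩)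

theorem card_near_le {N : ℕ} (c : Fin N) {ℓ : ℝ} (hℓ : 0 ≤ ℓ) [DecidablePred fun k : Fin N =>
    |(k : ℝ) - (c : ℝ)| ≤ ℓ] :
    ((Finset.univ.filter fun k : Fin N => |(k : ℝ) - (c : ℝ)| ≤ ℓ).card : ℝ) ≤ 2 * ℓ + 1 := by
  have h : (Finset.univ.filter fun k : Fin N => |(k : ℝ) - (c : ℝ)| ≤ ℓ).card ≤
      (Finset.Icc ((c : ℕ) - ⌊ℓ⌋₊) ((c : ℕ) + ⌊ℓ⌋₊)).card := by
    refine Finset.card_le_card_of_injOn (fun k => (k : ℕ)) ?_ (fun a _ b _ h => Fin.ext h)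
    intro k hk
    simp only [Finset.coe_filter, Finset.mem_univ, true_and, Set.mem_ofPred_eq] at hk
    have h1 : |((k : ℕ) : ℤ) - ((c : ℕ) : ℤ)|.toNat ≤ ⌊ℓ⌋₊ := by
      refine Nat.le_floor ?_
      have : ((|((k : ℕ) : ℤ) - ((c : ℕ) : ℤ)|.toNat : ℤ) : ℝ) ≤ ℓ := by
        rw [Int.toNat_of_nonneg (abs_nonneg _)]
        push_cast
        exact hk
      exact_mod_cast this
    simp only [Finset.coe_Icc, Set.mem_Icc]
    rcases abs_cases (((k : ℕ) : ℤ) - ((c : ℕ) : ℤ)) with ⟨h2, h3⟩ | ⟨h2, h3⟩ <;>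
    · rw [h2] at h1
      omega
  have h2 : (Finset.Icc ((c : ℕ) - ⌊ℓ⌋₊) ((c : ℕ) + ⌊ℓ⌋₊)).card ≤ 2 * ⌊ℓ⌋₊ + 1 := by
    rw [Nat.card_Icc]; omega
  have h3 : ((Finset.univ.filter fun k : Fin N => |(k : ℝ) - (c : ℝ)| ≤ ℓ).card : ℝ) ≤
      2 * (⌊ℓ⌋₊ : ℝ) + 1 := by exact_mod_cast h.trans h2
  linarith [Nat.floor_le hℓ]

open Classical in
theorem card_siteClass_le {y : Fin n → Fin N} {ℓ : ℝ} (hℓ : 0 < ℓ) {i j : Fin N} (hij : i ≠ j)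
    (hr : localRel y ℓ i j) :
    ((Finset.univ.filter fun k => siteClass y ℓ k = siteClass y ℓ i).card : ℝ) ≤
      3 * (n + 1) * ℓ := by
  obtain h0 | ⟨h1, -, h3⟩ := near_of_localRel hr
  · exact absurd h0 hij
  have hsub : (Finset.univ.filter fun k => siteClass y ℓ k = siteClass y ℓ i) ⊆
      Finset.univ.biUnion fun a => Finset.univ.filter fun k : Fin N =>
        |(k : ℝ) - (y a : ℝ)| ≤ ℓ := by
    intro k hk
    simp only [Finset.mem_filter, Finset.mem_univ, true_and, Finset.mem_biUnion] at hk ⊢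
    rcases near_of_localRel (siteClass_eq_iff.1 hk) with rfl | ⟨h, -⟩
    · exact h1
    · exact h
  calc ((Finset.univ.filter fun k => siteClass y ℓ k = siteClass y ℓ i).card : ℝ)
      ≤ ((∑ a : Fin n, (Finset.univ.filter fun k : Fin N =>
          |(k : ℝ) - (y a : ℝ)| ≤ ℓ).card : ℕ) : ℝ) :=
        Nat.cast_le.2 ((Finset.card_le_card hsub).trans Finset.card_biUnion_le)
    _ ≤ ∑ a : Fin n, (2 * ℓ + 1) := by
        rw [Nat.cast_sum]
        exact Finset.sum_le_sum fun a _ => card_near_le (y a) hℓ.le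
    _ = n * (2 * ℓ + 1) := by rw [Finset.sum_const, nsmul_eq_mul, Finset.card_univ, Fintype.card_fin]
    _ ≤ 3 * (n + 1) * ℓ := by
        have : (0 : ℝ) ≤ n := Nat.cast_nonneg n
        nlinarith

open Classical in
theorem sub_le_card_siteClass {y : Fin n → Fin N} {ℓ : ℝ} {i j : Fin N} (hij : i < j)
    (hr : localRel y ℓ i j) :
    |(i : ℝ) - (j : ℝ)| ≤
      ((Finset.univ.filter fun k => siteClass y ℓ k = siteClass y ℓ i).card : ℝ) := by
  have hsub : Finset.Icc i j ⊆
      Finset.univ.filter fun k => siteClass y ℓ k = siteClass y ℓ i := by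
    intro k hk
    rw [Finset.mem_Icc] at hk
    simp only [Finset.mem_filter, Finset.mem_univ, true_and]
    exact (siteClass_eq_iff.2 (localRel_of_between hr k (Or.inl hk))).symm
  have h := Finset.card_le_card hsub
  rw [Fin.card_Icc] at h
  have hlt : (i : ℕ) < (j : ℕ) := hij
  have h2 : (j : ℕ) ≤
      (Finset.univ.filter fun k => siteClass y ℓ k = siteClass y ℓ i).card + (i : ℕ) := by omega
  have h3 : ((j : ℕ) : ℝ) ≤
      ((Finset.univ.filter fun k => siteClass y ℓ k = siteClass y ℓ i).card : ℝ) + (i : ℕ) := by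
    exact_mod_cast h2
  have h4 : ((i : ℕ) : ℝ) < (j : ℕ) := by exact_mod_cast hlt
  rw [abs_of_neg (by linarith)]
  linarith

-- With m the class size, |i - j| ≤ m gives c_ij ≥ υ/m², so 1/m = (m/υ)(υ/m²) ≤ (m/υ) c_ij, and m ≤
-- 3(n+1)ℓ.
open Classical in
theorem avg_siteClass_le {c : Fin N → Fin N → ℝ} {υ : ℝ} (hυ : 0 < υ)
    (hc : SubquadraticDecay c υ) {y : Fin n → Fin N} {ℓ : ℝ} (hℓ : 0 < ℓ) {i j : Fin N}
    (hij : i < j) (hr : localRel y ℓ i j) :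
    avg (siteClass y ℓ) i j ≤ 3 * (n + 1) * (ℓ / υ) * c i j := by
  have h1 := card_siteClass_le hℓ hij.ne hr
  have h2 := sub_le_card_siteClass hij hr
  have hd : 0 < |(i : ℝ) - (j : ℝ)| := by
    rw [abs_pos, sub_ne_zero]
    exact fun h => hij.ne (Fin.ext (by exact_mod_cast h))
  have h3 := hc i j hij
  rw [avg, if_pos (siteClass_eq_iff.2 hr)]
  set m : ℝ := ((Finset.univ.filter fun k => siteClass y ℓ k = siteClass y ℓ i).card : ℝ)
  set d : ℝ := |(i : ℝ) - (j : ℝ)|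
  have hm : 0 < m := hd.trans_le h2
  have h4 : υ / m ^ 2 ≤ c i j := by
    refine le_trans ?_ h3.le
    rw [zpow_neg, ← div_eq_mul_inv]
    exact div_le_div_of_nonneg_left hυ.le (by positivity)
      (by exact_mod_cast pow_le_pow_left₀ hd.le h2 2)
  calc m⁻¹ = m / υ * (υ / m ^ 2) := by field_simp
    _ ≤ 3 * (n + 1) * (ℓ / υ) * (υ / m ^ 2) := by
        refine mul_le_mul_of_nonneg_right ?_ (by positivity)
        rw [← mul_div_assoc]
        exact div_le_div_of_nonneg_right h1 hυ.le
    _ ≤ _ := mul_le_mul_of_nonneg_left h4 (by positivity)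

theorem sum_sum_eq_two_mul_sum_lt {ι : Type*} [Fintype ι] [LinearOrder ι] (g : ι → ι → ℝ)
    (hs : ∀ i j, g i j = g j i) (h0 : ∀ i, g i i = 0) :
    ∑ i, ∑ j, g i j = 2 * ∑ i, ∑ j, if i < j then g i j else 0 := by
  have h : ∀ i j, g i j = (if i < j then g i j else 0) + if j < i then g j i else 0 := by
    intro i j
    rcases lt_trichotomy i j with h | h | h
    · simp [h, h.not_gt]
    · simp [h, h0]
    · simp [h, h.not_gt, hs i j]
  rw [Finset.sum_congr rfl fun i _ => Finset.sum_congr rfl fun j _ => h i j]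
  simp only [Finset.sum_add_distrib]
  rw [Finset.sum_comm (f := fun i j => if j < i then g j i else 0)]
  ring

open Classical in
theorem sum_mul_casimir_le_localDirichlet {c : Fin N → Fin N → ℝ} {υ : ℝ} (hυ : 0 < υ)
    (hc : SubquadraticDecay c υ) (y : Fin n → Fin N) {ℓ : ℝ} (hℓ : 0 < ℓ)
    (f : (Fin n → Fin N) → ℝ) :
    ∑ x, localTensor y ℓ f x * casimir (siteClass y ℓ) Finset.univ (localTensor y ℓ f) x ≤
      3 * (n + 1) * (ℓ / υ) * localDirichlet c y ℓ f := by
  rw [sum_mul_casimir, sum_sum_eq_two_mul_sum_lt, ← mul_assoc, localDirichlet, Finset.mul_sum,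
    Finset.mul_sum]
  · refine Finset.sum_le_sum fun i _ => ?_
    rw [Finset.mul_sum, Finset.mul_sum, Finset.sum_filter]
    refine Finset.sum_le_sum fun j _ => ?_
    by_cases hij : i < j
    · by_cases hr : localRel y ℓ i j
      · rw [if_pos hij, if_pos ⟨hij, hr⟩, localInner_neg_gen hij.ne hr, ← mul_assoc, ← mul_assoc]
        refine mul_le_mul_of_nonneg_right ?_ (Finset.sum_nonneg fun x _ => sq_nonneg _)
        linarith [avg_siteClass_le hυ hc hℓ hij hr]
      · rw [if_pos hij, if_neg fun h => hr h.2, avg, if_neg fun h => hr (siteClass_eq_iff.1 h)]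
        simp
    · rw [if_neg hij, if_neg fun h => hij h.1]
      simp
  · intro i j
    rw [avg_comm]
    congr 1
    refine Finset.sum_congr rfl fun x _ => ?_
    simp only [rot, LinearMap.sub_apply, Pi.sub_apply]
    ring
  · intro i
    simp [rot]

end Classes

/-! ### Distance to the kernel of a symmetric operator with a gap -/

section Spectral

open scoped InnerProductSpace

/-- Diagonalise T on the invariant subspace U. F₀ is the orthogonal projection of F onto the kernel
of T in U, and every other spectral component carries an eigenvalue of at least δ. -/
theorem exists_kernel_projection {ι : Type*} [Fintype ι] (T : Module.End ℝ (ι → ℝ))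
    (hT : ∀ F G : ι → ℝ, ∑ x, T F x * G x = ∑ x, F x * T G x) (U : Submodule ℝ (ι → ℝ))
    (hU : ∀ F ∈ U, T F ∈ U) {δ : ℝ}
    (hδ : ∀ F ∈ U, F ≠ 0 → ∀ μ : ℝ, μ ≠ 0 → T F = μ • F → δ ≤ μ) {F : ι → ℝ} (hF : F ∈ U) :
    ∃ F₀ ∈ U, T F₀ = 0 ∧ δ * ∑ x, (F x - F₀ x) ^ 2 ≤ ∑ x, F x * T F x := by
  let e : EuclideanSpace ℝ ι ≃ₗ[ℝ] (ι → ℝ) := WithLp.linearEquiv 2 ℝ (ι → ℝ)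
  have hinner : ∀ u v : EuclideanSpace ℝ ι, ⟪u, v⟫_ℝ = ∑ x, e u x * e v x := by
    intro u v
    rw [PiLp.inner_apply]
    exact Finset.sum_congr rfl fun x _ => mul_comm _ _
  let U' : Submodule ℝ (EuclideanSpace ℝ ι) := U.comap e.toLinearMap
  let T' : EuclideanSpace ℝ ι →ₗ[ℝ] EuclideanSpace ℝ ι := e.symm.toLinearMap ∘ₗ T ∘ₗ e.toLinearMap
  have heT : ∀ u, e (T' u) = T (e u) := fun u => e.apply_symm_apply _
  have hTU : ∀ u ∈ U', T' u ∈ U' := fun u hu => by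
    change e (T' u) ∈ U
    rw [heT]
    exact hU _ hu
  have hsym : T'.IsSymmetric := by
    intro u v
    rw [hinner, hinner, heT, heT, hT]
  have hR := hsym.restrict_invariant hTU
  set R := T'.restrict hTU
  have hRe : ∀ u : U', e (R u) = T (e u) := fun u => heT u
  let b := hR.eigenvectorBasis rfl
  let lam := hR.eigenvalues rfl
  have hb : ∀ k, R (b k) = lam k • b k := fun k => hR.apply_eigenvectorBasis rfl k
  let v : U' := ⟨e.symm F, by change e (e.symm F) ∈ U; rwa [e.apply_symm_apply]⟩
  have hev : e v = F := e.apply_symm_apply F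
  let v₀ : U' := ∑ k, (if lam k = 0 then ⟪b k, v⟫_ℝ else 0) • b k
  have hlam : ∀ k, lam k ≠ 0 → δ ≤ lam k := by
    intro k hk
    refine hδ (e (b k)) (b k).2 ?_ (lam k) hk ?_
    · intro h
      have h1 : b k = 0 := Subtype.ext (e.injective (by rw [h]; exact (map_zero e).symm))
      exact b.toBasis.ne_zero k (by simpa using h1)
    · rw [← hRe, hb]
      exact map_smul e (lam k) _
  have hcoef : ∀ k, ⟪b k, v - v₀⟫_ℝ = if lam k = 0 then 0 else ⟪b k, v⟫_ℝ := by
    intro k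
    have h1 : ⟪b k, v₀⟫_ℝ = if lam k = 0 then ⟪b k, v⟫_ℝ else 0 := by
      exact b.orthonormal.inner_right_fintype _ k
    rw [inner_sub_right, h1]
    split_ifs <;> simp
  refine ⟨e v₀, v₀.2, ?_, ?_⟩
  · rw [← hRe]
    have : R v₀ = 0 := by
      simp only [v₀, map_sum, map_smul, hb]
      refine Finset.sum_eq_zero fun k _ => ?_
      by_cases h : lam k = 0 <;> simp [h]
    rw [this]
    exact map_zero e
  · have h1 : ∑ x, (F x - e v₀ x) ^ 2 = ∑ k, ⟪b k, v - v₀⟫_ℝ ^ 2 := by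
      have h2 := b.sum_inner_mul_inner (v - v₀) (v - v₀)
      have h3 : ⟪v - v₀, v - v₀⟫_ℝ = ∑ x, (F x - e v₀ x) ^ 2 := by
        rw [Submodule.coe_inner, hinner]
        refine Finset.sum_congr rfl fun x _ => ?_
        rw [Submodule.coe_sub, map_sub, hev, Pi.sub_apply, sq]
      rw [← h3, ← h2]
      exact Finset.sum_congr rfl fun k _ => by rw [real_inner_comm, sq]
    have h4 : ∑ x, F x * T F x = ∑ k, lam k * ⟪b k, v⟫_ℝ ^ 2 := by
      have h2 := b.sum_inner_mul_inner v (R v)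
      have h3 : ⟪v, R v⟫_ℝ = ∑ x, F x * T F x := by
        rw [Submodule.coe_inner, hinner, hRe, hev]
      rw [← h3, ← h2]
      refine Finset.sum_congr rfl fun k _ => ?_
      rw [← hR (b k) v, hb, real_inner_smul_left, real_inner_comm]
      ring
    rw [h1, h4, Finset.mul_sum]
    refine Finset.sum_le_sum fun k _ => ?_
    rw [hcoef]
    by_cases h : lam k = 0
    · simp [h]
    · rw [if_neg h]
      exact mul_le_mul_of_nonneg_right (hlam k h) (sq_nonneg _)

end Spectral

/-! ### Tensors on the local neighborhood -/

section Local

variable {n N : ℕ}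

theorem mem_localNbhd_iff {y : Fin n → Fin N} {ℓ : ℝ} (x : Fin n → Fin N) :
    x ∈ localNbhd y ℓ ↔
      x ∈ evenConfigs n N ∧ ∀ a, siteClass y ℓ (x a) = siteClass y ℓ (y a) := by
  simp only [localNbhd, Finset.mem_filter, siteClass_eq_iff]

/-- The tensors supported on the local neighborhood. -/
def localTensors (y : Fin n → Fin N) (ℓ : ℝ) : Submodule ℝ ((Fin n → Fin N) → ℝ) where
  carrier := {F | ∀ x ∉ localNbhd y ℓ, F x = 0}
  add_mem' hF hG x hx := by simp [hF x hx, hG x hx]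
  zero_mem' _ _ := rfl
  smul_mem' r F hF x hx := by simp [hF x hx]

theorem localTensor_mem (y : Fin n → Fin N) (ℓ : ℝ) (f : (Fin n → Fin N) → ℝ) :
    localTensor y ℓ f ∈ localTensors y ℓ := fun _ hx => if_neg hx

theorem evenOn_of_mem_localTensors {y : Fin n → Fin N} {ℓ : ℝ} {F : (Fin n → Fin N) → ℝ}
    (hF : F ∈ localTensors y ℓ) : EvenOn Finset.univ F := by
  intro x hx i
  have h : x ∈ localNbhd y ℓ := by by_contra h; exact hx (hF x h)
  have := ((mem_localNbhd_iff x).1 h).1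
  simp only [evenConfigs, Finset.mem_filter, Finset.mem_univ, true_and] at this
  exact this i

-- Exchanges and contractions act within classes and preserve parity of occupation numbers;
-- `classInv` is diagonal.
open Classical in
theorem casimir_mem_localTensors {y : Fin n → Fin N} {ℓ : ℝ} {F : (Fin n → Fin N) → ℝ}
    (hF : F ∈ localTensors y ℓ) :
    casimir (siteClass y ℓ) Finset.univ F ∈ localTensors y ℓ := by
  have hex : ∀ a b : Fin n, a ≠ b → exchange (siteClass y ℓ) a b F ∈ localTensors y ℓ := by
    intro a b hab x hx
    rw [exchange_apply _ hab]
    by_cases h : avg (siteClass y ℓ) (x a) (x b) = 0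
    · rw [h, zero_mul]
    have h := class_eq_of_avg_ne h
    rw [hF _ fun h' => hx ?_, mul_zero]
    rw [mem_localNbhd_iff] at h' ⊢
    refine ⟨?_, fun c => ?_⟩
    · have := h'.1
      simp only [evenConfigs, Finset.mem_filter, Finset.mem_univ, true_and,
        particleNumber_comp] at this ⊢
      exact this
    · rw [← h'.2 c, Function.comp_apply, Equiv.swap_apply_def]
      split_ifs with h1 h2
      · rw [h1, h]
      · rw [h2, h]
      · rfl
  have hco : ∀ a b : Fin n, a ≠ b → contract (siteClass y ℓ) a b F ∈ localTensors y ℓ := by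
    intro a b hab x hx
    rw [contract_apply _ hab]
    split_ifs with hxab
    swap
    · rfl
    refine Finset.sum_eq_zero fun k _ => ?_
    by_cases h : avg (siteClass y ℓ) (x a) k = 0
    · rw [h, zero_mul]
    have h := class_eq_of_avg_ne h
    rw [hF _ fun h' => hx ?_, mul_zero]
    rw [mem_localNbhd_iff] at h' ⊢
    obtain ⟨h1, h2⟩ := h'
    simp only [evenConfigs, Finset.mem_filter, Finset.mem_univ, true_and] at h1 ⊢
    have hself : Function.update (Function.update x a (x a)) b (x a) = x := by
      rw [Function.update_eq_self, hxab, Function.update_eq_self]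
    have hp : ∀ l i, particleNumber i (Function.update (Function.update x a l) b l) = _ :=
      fun l i => card_filter_update_pair (Finset.mem_univ a) (Finset.mem_univ b) hab x i l
    refine ⟨fun i => ?_, fun c => ?_⟩
    · have h3 := h1 i
      rw [hp] at h3
      rw [← hself, hp]
      have h4 : ∀ p : Prop, [Decidable p] → Even (if p then 2 else 0) := fun p _ => by
        split_ifs <;> decide
      rw [Nat.even_add] at h3 ⊢
      exact iff_of_true (h3.2 (h4 _)) (h4 _)
    · have h3 := h2 c
      by_cases hcb : c = b
      · rw [hcb, Function.update_self] at h3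
        rw [hcb, ← hxab, h, h3]
      by_cases hca : c = a
      · rw [hca, Function.update_of_ne hab, Function.update_self] at h3
        rw [hca, h, h3]
      · rwa [Function.update_of_ne hcb, Function.update_of_ne hca] at h3
  have hcl : ∀ a : Fin n, classInv (siteClass y ℓ) a F ∈ localTensors y ℓ := by
    intro a x hx
    rw [classInv_apply, hF x hx, mul_zero]
  rw [casimir_eq_sub, LinearMap.sub_apply, glPart, LinearMap.sum_apply, LinearMap.sum_apply]
  refine Submodule.sub_mem _ (Submodule.sum_mem _ fun a _ => ?_) (Submodule.sum_mem _ fun a _ => ?_)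
  · rw [LinearMap.add_apply, LinearMap.sub_apply, LinearMap.sum_apply]
    exact Submodule.add_mem _ (Submodule.sub_mem _ hF (hcl a))
      (Submodule.sum_mem _ fun b hb => hex a b (Finset.ne_of_mem_erase hb).symm)
  · rw [LinearMap.sum_apply]
    exact Submodule.sum_mem _ fun b hb => hco a b (Finset.ne_of_mem_erase hb).symm

theorem localProj_sub (y : Fin n → Fin N) (ℓ : ℝ) (f g : (Fin n → Fin N) → ℝ)
    (x : Fin n → Fin N) :
    localProj y ℓ (f - g) x = localProj y ℓ f x - localProj y ℓ g x := by
  simp only [localProj, Pi.sub_apply, mul_sub, Finset.sum_sub_distrib, sub_div]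

open Classical in
theorem localProj_eq_self_of_casimir_eq_zero {y : Fin n → Fin N} {ℓ : ℝ}
    {F : (Fin n → Fin N) → ℝ} (hF : F ∈ localTensors y ℓ)
    (h : casimir (siteClass y ℓ) Finset.univ F = 0) {x : Fin n → Fin N}
    (hx : x ∈ localNbhd y ℓ) :
    localProj y ℓ (fun z => F z / matchCount z) x = F x / matchCount x := by
  have hmem : F ∈ pairSpan (siteClass y ℓ) y Finset.univ 1 := by
    refine mem_pairSpan_of_casimir_eq_zero _ y _ 1 (mul_one 1) (by simp) F
      (evenOn_of_mem_localTensors hF) (fun z hz => ⟨rfl, ?_⟩) (fun z w _ _ hzw => ?_) h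
    · have : z ∈ localNbhd y ℓ := by by_contra h'; exact hz (hF z h')
      exact ((mem_localNbhd_iff z).1 this).2
    · rw [funext fun a => hzw a (Finset.mem_univ a)]
  have hpos : ∀ z ∈ localNbhd y ℓ, 0 < matchCount z := fun z hz =>
    matchCount_pos ((mem_localNbhd_iff z).1 hz).1
  have hw : 0 < ∑ z ∈ (localNbhd y ℓ).filter
      (fun z => positionPartition z ≤ positionPartition x), weight z := by
    refine Finset.sum_pos' (fun z _ => weight_nonneg z)
      ⟨x, Finset.mem_filter.2 ⟨hx, le_rfl⟩, ?_⟩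
    rw [weight_eq_matchCount_sq]
    exact pow_pos (hpos x hx) 2
  rw [localProj, div_eq_div_iff hw.ne' (hpos x hx).ne',
    mul_sum_weight_of_mem_pairSpan _ y mem_localNbhd_iff hmem hx, mul_comm]
  congr 1
  refine Finset.sum_congr rfl fun z hz => ?_
  have := hpos z (Finset.mem_filter.1 hz).1
  rw [weight_eq_matchCount_sq]
  field_simp

theorem sum_weight_mul_sub_localProj_sq_le (y : Fin n → Fin N) (ℓ : ℝ)
    (g : (Fin n → Fin N) → ℝ) :
    ∑ x ∈ localNbhd y ℓ, weight x * (g x - localProj y ℓ g x) ^ 2 ≤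
      2 * (1 + Fintype.card (Setoid (Fin n))) * ∑ x ∈ localNbhd y ℓ, weight x * g x ^ 2 := by
  have h1 : ∑ x ∈ localNbhd y ℓ, weight x * (g x - localProj y ℓ g x) ^ 2 ≤
      ∑ x ∈ localNbhd y ℓ, (2 * (weight x * g x ^ 2) +
        2 * (weight x * localProj y ℓ g x ^ 2)) :=
    Finset.sum_le_sum fun x _ => by
      nlinarith [mul_nonneg (weight_nonneg x) (sq_nonneg (g x + localProj y ℓ g x))]
  rw [Finset.sum_add_distrib, ← Finset.mul_sum, ← Finset.mul_sum] at h1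
  linarith [sum_weight_mul_localProj_sq_le y ℓ g]

end Local

end ColoredFlow

/-! ### The Poincaré inequality -/

theorem proposition6p3 (n : ℕ) :
    ∃ C : ℝ, 0 < C ∧
      ∀ (N : ℕ) (c : Fin N → Fin N → ℝ) (υ : ℝ), 0 < υ → ColoredFlow.SubquadraticDecay c υ →
        ∀ y ∈ ColoredFlow.evenConfigs n N, ∀ ℓ : ℝ, 0 < ℓ → ∀ f : (Fin n → Fin N) → ℝ,
          ∑ x ∈ ColoredFlow.localNbhd y ℓ,
              ColoredFlow.weight x * |f x - ColoredFlow.localProj y ℓ f x| ^ 2 ≤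
            C * (ℓ / υ) * ColoredFlow.localDirichlet c y ℓ f := by
  classical
  -- The factor 12 is 2 (bounding 1 - P) times 2 (inverse of the gap 1/2) times 3 (class size).
  refine ⟨12 * (n + 1) * (1 + Fintype.card (Setoid (Fin n))), by positivity, ?_⟩
  intro N c υ hυ hc y _ ℓ hℓ f
  obtain ⟨F₀, hF₀, hker, hle⟩ := ColoredFlow.exists_kernel_projection
    (ColoredFlow.casimir (ColoredFlow.siteClass y ℓ) Finset.univ)
    (ColoredFlow.casimir_symm _ _) (ColoredFlow.localTensors y ℓ)
    (fun F hF => ColoredFlow.casimir_mem_localTensors hF)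
    (fun F hF hF0 μ hμ h => ColoredFlow.half_le_eigenvalue _ hμ _
      (ColoredFlow.evenOn_of_mem_localTensors hF) hF0 h)
    (ColoredFlow.localTensor_mem y ℓ f)
  set f₀ : (Fin n → Fin N) → ℝ := fun z => F₀ z / ColoredFlow.matchCount z with hf₀
  have h1 : ∑ x ∈ ColoredFlow.localNbhd y ℓ,
      ColoredFlow.weight x * |f x - ColoredFlow.localProj y ℓ f x| ^ 2 =
      ∑ x ∈ ColoredFlow.localNbhd y ℓ,
        ColoredFlow.weight x * ((f - f₀) x - ColoredFlow.localProj y ℓ (f - f₀) x) ^ 2 := by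
    -- Since P fixes f₀, replacing f by f - f₀ does not change f - Pf.
    refine Finset.sum_congr rfl fun x hx => ?_
    rw [sq_abs, ColoredFlow.localProj_sub,
      ColoredFlow.localProj_eq_self_of_casimir_eq_zero hF₀ hker hx, Pi.sub_apply]
    ring
  have h2 : ∑ x ∈ ColoredFlow.localNbhd y ℓ, ColoredFlow.weight x * (f - f₀) x ^ 2 =
      ∑ x, (ColoredFlow.localTensor y ℓ f x - F₀ x) ^ 2 := by
    rw [← Finset.sum_subset (Finset.subset_univ (ColoredFlow.localNbhd y ℓ))]
    · refine Finset.sum_congr rfl fun x hx => ?_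
      have := ColoredFlow.matchCount_pos ((ColoredFlow.mem_localNbhd_iff x).1 hx).1
      rw [ColoredFlow.localTensor_apply f hx, ColoredFlow.weight_eq_matchCount_sq, Pi.sub_apply,
        hf₀]
      field_simp
    · intro x _ hx
      rw [ColoredFlow.localTensor_mem y ℓ f x hx, hF₀ x hx]
      simp
  rw [h1]
  refine (ColoredFlow.sum_weight_mul_sub_localProj_sq_le y ℓ (f - f₀)).trans ?_
  rw [h2]
  have h3 := hle.trans (ColoredFlow.sum_mul_casimir_le_localDirichlet hυ hc y hℓ f)
  have hB : (0 : ℝ) ≤ 4 * (1 + Fintype.card (Setoid (Fin n))) := by positivity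
  have h4 := mul_le_mul_of_nonneg_left h3 hB
  linarith
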